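/- **Expectation of the kinetic energy.** Let $k_F$ be a radius such that the Fermi ball $B_F=\{h\in\mathbb Z^3:|h|\le k_F\}$ has exactly $N\ge 1$ points, $B_F^c=\mathbb Z^3\setminus B_F$, $\hbar=N^{-1/3}$. On the fermionic Fock space over $L^2(\mathbb T^3)$, $\mathbb T^3=[0,2\pi]^3$ periodic, let $a_p^*,a_p$ create/annihilate the plane wave $(2\pi)^{-3/2}e^{ip\cdot x}$, let $\Omega$ be the vacuum, $\mathcal N$ the number operator, and $$\mathbb H_0=\sum_{p\in B_F^c}\hbar^2|p|^2a_p^*a_p-\sum_{h\in B_F}\hbar^2|h|^2a_h^*a_h .$$ For $k\in\mathbb Z^3$ put $$\tilde b_k^*=\sum_{p\in B_F^c,\,h\in B_F}\delta_{p,h+k}\,a_p^*a_h^*,\qquad n_k=\|\tilde b_k^*\Omega\|,\qquad b_k^*=\frac{1}{n_k}\tilde b_k^*\ (k\neq0),\qquad f(k)=\frac1{n_k^2}\sum_{p\in B_F^c,\,h\in B_F}\delta_{p,h+k}\,(p+h)\in\mathbb R^3 .$$ Let $\Xi:\mathbb Z^3\to\mathbb C$ satisfy $\Xi(-k)=\Xi(k)$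 and $\sum_k|k|^2|\Xi(k)|<\infty$ (for instance, $\Xi$ finitely supported), and let $$B=\tfrac12\sum_{k\in\mathbb Z^3\setminus\{0\}}\Xi(k)\,b_k^*b_{-k}^*-\text{h.c.},\qquad T(t)=e^{tB},\qquad T=T(1).$$ The series defining $B$ converges in operator norm. Then $T\Omega$ is in the domain of $\mathbb H_0$, the number $$M:=\sup_{t\in[0,1]}\|(\mathcal N+2)^{3/2}T(t)\Omega\|$$ is finite (each $T(t)\Omega$, $t\in[0,1]$, being in the domain of $(\mathcal N+2)^{3/2}$), all the series below converge, and there is $\varepsilon_2\in\mathbb C$ with $$\langle T\Omega,\mathbb H_0T\Omega\rangle=\sum_{k\in\mathbb Z^3\setminus\{0\}}\hbar^2\,k\cdot f(k)\,\sinh^2|\Xi(k)|+2\,\mathrm{Re}\,\varepsilon_2$$ and $$\begin{aligned}|\varepsilon_2|\le 2\hbar^2\sum_{k\in\mathbb Z^3\setminus\{0\}}\Bigg[&2|\Xi(k)|\,|k\cdot f(k)|\,\sinh|\Xi(k)|\;M\,e^{|\Xi(k)|}\sum_{m\ne0}\frac{2|\Xi(m)|}{n_mn_k}\\&+\sum_{l\neq0}|\Xi(l)|\,\frac{\max\{(6/\pi)^{1/3}N^{1/3},|k|\}\,|k|}{n_kn_l}\,M\Big(\sinh|\Xi(k)|+M\,\sinh|\Xi(k)|\,e^{|\Xi(k)|}\sum_{m\neq0}\frac{|\Xi(m)|}{n_mn_k}\Big)\Bigg].\end{aligned}$$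 -/

import Mathlib

open scoped InnerProductSpace

noncomputable section

namespace FermiGas

/-! ### Momentum lattice and Fermi ball -/

/-- Momenta of plane waves on the torus `[0, 2π]³`: the lattice `ℤ³`. -/
abbrev Mode : Type := Fin 3 → ℤ

/-- Nonzero momenta, the index set of all sums over `ℤ³ \ {0}`. -/
abbrev NZ : Type := {k : Mode // k ≠ 0}

/-- A lattice momentum as a vector of Euclidean `ℝ³`. -/
def vec (k : Mode) : EuclideanSpace ℝ (Fin 3) := WithLp.toLp 2 fun i => (k i : ℝ)

theorem finite_fermiBall (kF : ℝ) : {h : Mode | ‖vec h‖ ≤ kF}.Finite := by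
  refine (Set.Finite.pi' (t := fun _ : Fin 3 => Set.Icc (-⌈kF⌉) ⌈kF⌉)
    (fun _ => Set.finite_Icc _ _)).subset fun h hh i => ?_
  have h1 : |(h i : ℝ)| ≤ kF := by
    have h2 := PiLp.norm_apply_le (vec h) i
    simp only [vec, Real.norm_eq_abs] at h2
    exact h2.trans hh
  have h3 : |(h i : ℝ)| ≤ (⌈kF⌉ : ℝ) := h1.trans (Int.le_ceil kF)
  have h4 : |h i| ≤ ⌈kF⌉ := by exact_mod_cast h3
  exact abs_le.mp h4

/-- The Fermi ball `B_F`: the lattice points in the closed ball of radius `kF` around `0`. -/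
def fermiBall (kF : ℝ) : Finset Mode := (finite_fermiBall kF).toFinset

/-- The holes `h ∈ B_F` with `h + k ∉ B_F`; they index the pairs `(p, h)` with
`p ∈ B_F^c`, `h ∈ B_F` and `p = h + k`. -/
def lune (kF : ℝ) (k : Mode) : Finset Mode :=
  (fermiBall kF).filter fun h => h + k ∉ fermiBall kF

/-! ### Fermionic Fock space over `ℓ²(ℤ³) ≅ L²(𝕋³)` in the occupation number representation

The orthonormal basis vector of a finite set `S = {s₁ < ⋯ < sₙ}` of occupied plane waves is the
Slater determinant `a*_{s₁} ⋯ a*_{sₙ} Ω`, where the countably many modes are ordered along a fixed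
enumeration. -/

/-- The fermionic Fock space. -/
abbrev Fock : Type := lp (fun _ : Finset Mode => ℂ) 2

/-- The vacuum `Ω`. -/
def vacuum : Fock := lp.single 2 (∅ : Finset Mode) (1 : ℂ)

/-- The sign `(-1)^{#{q ∈ S : q < p}}`. -/
def jwSign (p : Mode) (S : Finset Mode) : ℂ :=
  (-1) ^ (S.filter fun q => Encodable.encode q < Encodable.encode p).card

/-- The coefficients of `a_p ψ`. -/
def annihilateFun (p : Mode) (ψ : Finset Mode → ℂ) (S : Finset Mode) : ℂ :=
  if p ∈ S then 0 else jwSign p S * ψ (insert p S)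

theorem norm_jwSign (p : Mode) (S : Finset Mode) : ‖jwSign p S‖ = 1 := by
  simp [jwSign]

theorem summable_annihilateFun (p : Mode) (ψ : Fock) :
    Summable (fun S => ‖annihilateFun p ψ S‖ ^ 2) ∧
      ∑' S, ‖annihilateFun p ψ S‖ ^ 2 ≤ ∑' S, ‖ψ S‖ ^ 2 := by
  classical
  have hψ : Summable (fun S => ‖ψ S‖ ^ 2) := by
    have h := (lp.memℓp ψ).summable (by norm_num)
    simpa using h
  let g : Finset Mode → Finset Mode := fun S => if p ∈ S then S.erase p else insert p S
  have hg : Function.Involutive g := by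
    intro S
    by_cases h : p ∈ S
    · simp [g, h]
    · simp [g, h]
  have hle : ∀ S, ‖annihilateFun p ψ S‖ ^ 2 ≤ ‖ψ (g S)‖ ^ 2 := by
    intro S
    by_cases h : p ∈ S
    · have h0 : annihilateFun p ψ S = 0 := if_pos h
      rw [h0]
      simp
    · simp [annihilateFun, g, h, norm_jwSign]
  have hgs : Summable (fun S => ‖ψ (g S)‖ ^ 2) := hψ.comp_injective hg.injective
  have hs : Summable (fun S => ‖annihilateFun p ψ S‖ ^ 2) :=
    Summable.of_nonneg_of_le (fun S => by positivity) hle hgs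
  refine ⟨hs, (hs.tsum_le_tsum hle hgs).trans (le_of_eq ?_)⟩
  exact (Equiv.ofBijective g hg.bijective).tsum_eq (fun S => ‖ψ S‖ ^ 2)

theorem memlp_annihilateFun (p : Mode) (ψ : Fock) : Memℓp (annihilateFun p ψ) 2 := by
  refine memℓp_gen ?_
  simpa using (summable_annihilateFun p ψ).1

/-- The annihilation operator `a_p` of the plane wave with momentum `p`. -/
def annihilate (p : Mode) : Fock →L[ℂ] Fock :=
  LinearMap.mkContinuous
    { toFun := fun ψ => ⟨annihilateFun p ψ, memlp_annihilateFun p ψ⟩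
      map_add' := by
        intro ψ φ
        ext S
        change annihilateFun p _ S = annihilateFun p ψ S + annihilateFun p φ S
        by_cases h : p ∈ S
        · simp [annihilateFun, h]
        · simp [annihilateFun, h, mul_add]
      map_smul' := by
        intro c ψ
        ext S
        by_cases h : p ∈ S
        · simp [annihilateFun, h]
        · simp [annihilateFun, h, mul_left_comm] }
    1 (by
      intro ψ
      have h1 := lp.norm_rpow_eq_tsum (p := 2) (by norm_num)
        (⟨annihilateFun p ψ, memlp_annihilateFun p ψ⟩ : Fock)
      have h2 := lp.norm_rpow_eq_tsum (p := 2) (by norm_num) ψ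
      have h3 := (summable_annihilateFun p ψ).2
      simp only [ENNReal.toReal_ofNat, Real.rpow_ofNat] at h1 h2
      rw [one_mul]
      refine le_of_sq_le_sq ?_ (norm_nonneg _)
      exact (h1.trans_le h3).trans_eq h2.symm)

/-- The creation operator `a*_p`. -/
def create (p : Mode) : Fock →L[ℂ] Fock := ContinuousLinearMap.adjoint (annihilate p)

/-- The operator that is diagonal in the occupation number basis with real eigenvalues `w S`, on
its maximal domain. -/
def diagOp (w : Finset Mode → ℝ) : Fock →ₗ.[ℂ] Fock where
  domain :=
    { carrier := {ψ | Memℓp (fun S => (w S : ℂ) * ψ S) 2}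
      add_mem' := by
        intro ψ φ hψ hφ
        simp only [Set.mem_ofPred_eq] at *
        convert hψ.add hφ using 1
        ext S
        simp [mul_add]
      zero_mem' := by
        simp only [Set.mem_ofPred_eq]
        convert (zero_memℓp : Memℓp (0 : Finset Mode → ℂ) 2) using 1
        ext S
        simp
      smul_mem' := by
        intro c ψ hψ
        simp only [Set.mem_ofPred_eq] at *
        convert hψ.const_smul c using 1
        ext S
        simp [mul_left_comm] }
  toFun :=
    { toFun := fun ψ => ⟨fun S => (w S : ℂ) * (ψ : Fock) S, ψ.2⟩
      map_add' := by
        intro ψ φ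
        ext S
        exact mul_add _ _ _
      map_smul' := by
        intro c ψ
        ext S
        simp [mul_left_comm] }

/-- Second quantization `dΓ(A) = ∑_p e(p) a*_p a_p` of the one-particle operator `A` with
`A f_p = e(p) f_p` on plane waves. -/
def dGamma (e : Mode → ℝ) : Fock →ₗ.[ℂ] Fock := diagOp fun S => ∑ p ∈ S, e p

/-- The operator `(𝒩 + 2)^{3/2}`, where `𝒩 = dΓ(1)` is the fermionic number operator. -/
def numberPlusTwoPow : Fock →ₗ.[ℂ] Fock := diagOp fun S => ((S.card : ℝ) + 2) ^ (3 / 2 : ℝ)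

/-! ### Semiclassical parameter, kinetic energy, pair operators -/

/-- `ħ = N^{-1/3}`. -/
def hbar (N : ℕ) : ℝ := (N : ℝ) ^ (-(1 / 3) : ℝ)

/-- `ℍ₀ = dΓ(u(-ħ²Δ)u - v̄(-ħ²Δ)v)`: a particle `p ∈ B_F^c` has energy `ħ²|p|²` and a hole
`h ∈ B_F` has energy `-ħ²|h|²`. -/
def kineticOp (N : ℕ) (kF : ℝ) : Fock →ₗ.[ℂ] Fock :=
  dGamma fun p => if p ∈ fermiBall kF then -(hbar N ^ 2 * ‖vec p‖ ^ 2)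
    else hbar N ^ 2 * ‖vec p‖ ^ 2

/-- The unnormalized pair creation operator
`∑_{p ∈ B_F^c, h ∈ B_F} δ_{p,h+k} a*_p a*_h`. -/
def pairCreate (kF : ℝ) (k : Mode) : Fock →L[ℂ] Fock :=
  ∑ h ∈ lune kF k, create (h + k) * create h

/-- The normalization constant `n_k`, the norm of the unnormalized pair state. -/
def pairNorm (kF : ℝ) (k : Mode) : ℝ := ‖pairCreate kF k vacuum‖

/-- The almost-bosonic creation operator `b*_k`. -/
def bStar (kF : ℝ) (k : Mode) : Fock →L[ℂ] Fock := ((pairNorm kF k : ℂ)⁻¹) • pairCreate kF k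

/-- The vector `f(k) = n_k^{-2} ∑_{p ∈ B_F^c, h ∈ B_F} δ_{p,h+k} (p + h)`. -/
def fVec (kF : ℝ) (k : Mode) : EuclideanSpace ℝ (Fin 3) :=
  (pairNorm kF k ^ 2)⁻¹ • ∑ h ∈ lune kF k, (vec (h + k) + vec h)

/-- The number `k · f(k)`. -/
def kDotF (kF : ℝ) (k : Mode) : ℝ := ⟪vec k, fVec kF k⟫_ℝ

/-! ### The trial state -/

/-- `½ ∑_{k ≠ 0} Ξ(k) b*_k b*_{-k}`. -/
def bogCreate (kF : ℝ) (Ξ : Mode → ℂ) : Fock →L[ℂ] Fock :=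
  (1 / 2 : ℂ) • ∑' k : NZ, Ξ k.1 • (bStar kF k.1 * bStar kF (-k.1))

/-- `B = ½ ∑_{k ≠ 0} Ξ(k) b*_k b*_{-k} - h.c.` -/
def bogGen (kF : ℝ) (Ξ : Mode → ℂ) : Fock →L[ℂ] Fock :=
  bogCreate kF Ξ - ContinuousLinearMap.adjoint (bogCreate kF Ξ)

/-- `T(t) = exp(tB)`. -/
def bogT (kF : ℝ) (Ξ : Mode → ℂ) (t : ℝ) : Fock →L[ℂ] Fock :=
  NormedSpace.exp ((t : ℂ) • bogGen kF Ξ)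

/-- The sum `∑_{m ≠ 0} |Ξ(m)| / (n_m n_k)`. -/
def xiSum (kF : ℝ) (Ξ : Mode → ℂ) (k : Mode) : ℝ :=
  ∑' m : NZ, ‖Ξ m.1‖ / (pairNorm kF m.1 * pairNorm kF k)

/-- The `k`-th summand of the error bound; `M` stands for
`sup_{t ∈ [0,1]} ‖(𝒩 + 2)^{3/2} T(t) Ω‖`. -/
def errorTerm (N : ℕ) (kF : ℝ) (Ξ : Mode → ℂ) (M : ℝ) (k : Mode) : ℝ :=
  2 * ‖Ξ k‖ * |kDotF kF k| * Real.sinh ‖Ξ k‖ * M * Real.exp ‖Ξ k‖ * (2 * xiSum kF Ξ k)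
    + max ((6 / Real.pi) ^ (1 / 3 : ℝ) * (N : ℝ) ^ (1 / 3 : ℝ)) ‖vec k‖ * ‖vec k‖
        * xiSum kF Ξ k * M
        * (Real.sinh ‖Ξ k‖ + M * (Real.sinh ‖Ξ k‖ * Real.exp ‖Ξ k‖) * xiSum kF Ξ k)

end FermiGas

end

/-!
# Kinetic energy of an almost-bosonic Bogoliubov trial state

Write `ψ_t = T(t) Ω`, `b_k` for the adjoint of `b*_k`, and `κ_k = ħ² k · f(k)`. The pair operators are
almost bosonic: `[b_k, b*_l] = δ_{k,l}` up to a one-body hopping operator of size `𝒩 / (n_k n_l)`.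
If the commutation relations were exact, `T(t)` would act on the pair `(b_k, b*_{-k})` as a hyperbolic
rotation by the angle `t |Ξ(k)|`, which produces the energy `∑ κ_k sinh² |Ξ(k)|`.

*Energy as a sum over momenta.* The commutator of the kinetic energy with `b*_k` is again a pair
operator `c*_k`, whose pairs `(p, h)` carry the weight `ħ² k · (p + h)`. Differentiating
`⟨ψ_t, ℍ₀ ψ_t⟩` therefore gives the sum over `k` of `2 Re Ξ(k) ⟨c_k ψ_t, b*_{-k} ψ_t⟩`
(`hasSum_pairEnergy_truncKinetic`). To avoid commutators with an unbounded operator this is done for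
the truncation of `ℍ₀` to finitely many modes, which is bounded. The condition `∑ |k|² |Ξ(k)| < ∞`
makes the estimates uniform in the truncation; this puts `ψ_1` in the domain of `ℍ₀` and, by dominated
convergence, gives the formula for `ℍ₀` itself (`inner_kineticOp_bogT`).

*One momentum.* The vectors `u = T(-t) b_k ψ_t`, `v = T(-t) b*_{-k} ψ_t`, `c = T(-t) c_k ψ_t` solve
`u' = Ξ v + ε₁`, `v' = Ξ̄ u + ε₂`, `c' = Ξ κ v + ε₃` (with `Ξ = Ξ(k)`). Grönwall's inequality compares
`v` with `cosh(t |Ξ|) v(0)`, and, up to the `ε₃` term, `2 Re Ξ ⟨c, v⟩` is the derivative of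
`κ |Ξ|² ‖∫₀ᵗ v‖²`, which makes the main term exact (`abs_integral_sub_sinh_sq_le`).

*Size of the perturbations.* `ε₁, ε₂, ε₃` are sums over `l` of `Ξ(l)` times products of a hopping
operator and a `b` or `b*`. A Schur test on configurations (`schur_moves`) bounds hopping operators by
`𝒩` and `b*_l` by `(𝒩/2 + 1)^{1/2}`, also in the presence of number weights, so each product is at
most `2^{-1/2} ‖(𝒩 + 2)^{3/2} ψ_t‖ / (n_k n_l)` (times the largest weight for `ε₃`).

*Finiteness of `M`.* The flow conserves the number of particles minus the number of holes, and there
are only `N` holes, so `𝒩 ≤ 2N` on `ψ_t`.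

*Constants.* The weights of `c_k` are at most `ħ² |k| (2 k_F + |k|)`. That this is at most
`2√2 ħ² |k| max{(6/π)^{1/3} N^{1/3}, |k|}` follows from a lower bound on the number of lattice points
in a ball (`cube_le_card_fermiBall`), and then the resulting error is below the stated one
(`modeError_le`).
-/


noncomputable section

namespace FermiGas

/-! ### Matrix elements of the field operators and the anticommutation relations -/

theorem annihilate_apply (p : Mode) (ψ : Fock) (S : Finset Mode) :
    annihilate p ψ S = if p ∈ S then 0 else jwSign p S * ψ (insert p S) := rfl

theorem jwSign_mul_self (p : Mode) (S : Finset Mode) : jwSign p S * jwSign p S = 1 := by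
  rw [jwSign, ← mul_pow]; simp

theorem conj_jwSign (p : Mode) (S : Finset Mode) :
    (starRingEnd ℂ) (jwSign p S) = jwSign p S := by
  simp [jwSign]

theorem jwSign_insert {p q : Mode} {S : Finset Mode} (hq : q ∉ S) :
    jwSign p (insert q S) =
      (if Encodable.encode q < Encodable.encode p then -1 else 1) * jwSign p S := by
  unfold jwSign
  rw [Finset.filter_insert]
  split_ifs with h
  · rw [Finset.card_insert_of_notMem (by simp [hq]), pow_succ]; ring
  · simp

theorem annihilate_single (p : Mode) (S : Finset Mode) :
    annihilate p (lp.single 2 S (1 : ℂ)) =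
      if p ∈ S then jwSign p (S.erase p) • (lp.single 2 (S.erase p) (1 : ℂ) : Fock) else 0 := by
  ext S'
  rw [annihilate_apply]
  by_cases hp : p ∈ S
  · rw [if_pos hp]
    simp only [lp.coeFn_smul, Pi.smul_apply, lp.single_apply, smul_eq_mul]
    by_cases hS : S' = S.erase p
    · subst hS
      simp [Finset.insert_erase hp]
    · rw [Pi.single_eq_of_ne hS]
      by_cases hp' : p ∈ S'
      · simp [hp']
      · rw [if_neg hp', Pi.single_eq_of_ne]
        · simp
        · rintro rfl
          exact hS (by simp [hp'])
  · rw [if_neg hp]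
    by_cases hp' : p ∈ S'
    · simp [hp']
    · rw [if_neg hp', lp.single_apply, Pi.single_eq_of_ne]
      · simp
      · rintro rfl
        simp at hp

theorem create_apply (p : Mode) (ψ : Fock) (S : Finset Mode) :
    create p ψ S = if p ∈ S then jwSign p (S.erase p) * ψ (S.erase p) else 0 := by
  have h : create p ψ S = inner ℂ (lp.single 2 S (1 : ℂ) : Fock) (create p ψ) := by
    rw [lp.inner_single_left]; simp
  rw [h, create, ContinuousLinearMap.adjoint_inner_right, annihilate_single]
  split_ifs with hp
  · rw [inner_smul_left, lp.inner_single_left, conj_jwSign]; simp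
  · simp

theorem star_annihilate (p : Mode) : star (annihilate p) = create p := rfl

theorem star_create (p : Mode) : star (create p) = annihilate p := by
  rw [← star_annihilate, star_star]

theorem norm_annihilate_le (p : Mode) : ‖annihilate p‖ ≤ 1 :=
  LinearMap.mkContinuous_norm_le _ zero_le_one _

theorem norm_create_le (p : Mode) : ‖create p‖ ≤ 1 := by
  rw [← star_annihilate]
  exact (norm_star (annihilate p)).trans_le (norm_annihilate_le p)

theorem annihilate_vacuum (p : Mode) : annihilate p vacuum = 0 := by
  rw [vacuum, annihilate_single]; simp

theorem encode_lt_or_gt {p q : Mode} (h : p ≠ q) :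
    (Encodable.encode p < Encodable.encode q ∧ ¬ Encodable.encode q < Encodable.encode p) ∨
    (Encodable.encode q < Encodable.encode p ∧ ¬ Encodable.encode p < Encodable.encode q) := by
  have := (Encodable.encode_injective (α := Mode)).ne h
  omega

/-- `a_p a_q = -a_q a_p`. -/
theorem annihilate_mul_annihilate (p q : Mode) :
    annihilate p * annihilate q = -(annihilate q * annihilate p) := by
  ext ψ S
  simp only [mul_apply_eq_comp, neg_apply, lp.coeFn_neg,
    Pi.neg_apply, annihilate_apply, Finset.mem_insert]
  rcases eq_or_ne p q with rfl | hpq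
  · simp
  · by_cases hp : p ∈ S <;> by_cases hq : q ∈ S <;> simp [hp, hq, hpq, hpq.symm]
    rw [jwSign_insert hp, jwSign_insert hq, Finset.insert_comm]
    rcases encode_lt_or_gt hpq with ⟨h1, h2⟩ | ⟨h1, h2⟩ <;> simp [h1, h2] <;> ring

/-- `a*_p a*_q = -a*_q a*_p`. -/
theorem create_mul_create (p q : Mode) : create p * create q = -(create q * create p) := by
  have h := congrArg star (annihilate_mul_annihilate q p)
  simpa [star_mul, star_annihilate] using h

/-- `a_p a*_q = δ_{p,q} - a*_q a_p`. -/
theorem annihilate_mul_create (p q : Mode) :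
    annihilate p * create q = (if p = q then 1 else 0) - create q * annihilate p := by
  ext ψ S
  rw [sub_apply, lp.coeFn_sub, Pi.sub_apply]
  simp only [mul_apply_eq_comp, annihilate_apply, create_apply, Finset.mem_insert]
  rcases eq_or_ne p q with rfl | hpq
  · by_cases hp : p ∈ S
    · simp [hp, ← mul_assoc, jwSign_mul_self, Finset.insert_erase hp]
    · simp [hp, ← mul_assoc, jwSign_mul_self, Finset.erase_insert hp]
  · by_cases hp : p ∈ S <;> by_cases hq : q ∈ S <;> simp [hp, hq, hpq, hpq.symm]
    obtain ⟨R, hR, rfl⟩ : ∃ R, q ∉ R ∧ S = insert q R :=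
      ⟨S.erase q, by simp, (Finset.insert_erase hq).symm⟩
    have hpR : p ∉ R := fun h => hp (Finset.mem_insert_of_mem h)
    rw [Finset.erase_insert hR, Finset.insert_comm, Finset.erase_insert (by simp [hR, hpq.symm]),
      jwSign_insert hR, jwSign_insert hpR]
    rcases encode_lt_or_gt hpq with ⟨h1, h2⟩ | ⟨h1, h2⟩ <;> simp [h1, h2] <;> ring

theorem annihilate_mul_create_of_ne {p q : Mode} (h : p ≠ q) :
    annihilate p * create q = -(create q * annihilate p) := by
  rw [annihilate_mul_create, if_neg h, zero_sub]

/-- Commutator of a particle-hole annihilator with a particle-hole creator, for particle momenta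
`p, p'` and hole momenta `h, h'`. -/
theorem pair_commutator {p h p' h' : Mode} (h1 : h ≠ p') (h2 : p ≠ h') :
    annihilate h * annihilate p * (create p' * create h')
        - create p' * create h' * (annihilate h * annihilate p) =
      (if p = p' then 1 else 0) * (if h = h' then 1 else 0)
        - (if p = p' then create h' * annihilate h else 0)
        - (if h = h' then create p' * annihilate p else 0) := by
  have e1 := annihilate_mul_create p p'
  have e2 := annihilate_mul_create h h'
  have e3 := annihilate_mul_create_of_ne h1
  have e4 := annihilate_mul_create_of_ne h2
  have e5 : annihilate h * annihilate p * (create p' * create h')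
      = annihilate h * (annihilate p * create p') * create h' := by noncomm_ring
  have e6 : annihilate h * (create p' * annihilate p) * create h'
      = (annihilate h * create p') * (annihilate p * create h') := by noncomm_ring
  have e7 : (-(create p' * annihilate h)) * (-(create h' * annihilate p))
      = create p' * (annihilate h * create h') * annihilate p := by noncomm_ring
  rw [e5, e1, mul_sub, sub_mul, e6, e3, e4, e7, e2]
  split_ifs <;> simp only [mul_one, mul_zero, zero_mul, e2] <;> simp_all <;> noncomm_ring

/-- `a*_p a*_h` and `a*_{p'} a*_{h'}` commute. -/
theorem create_pair_comm (p h p' h' : Mode) :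
    create p * create h * (create p' * create h') =
      create p' * create h' * (create p * create h) := by
  have e1 := create_mul_create h p'
  have e2 := create_mul_create h h'
  have e3 := create_mul_create p p'
  have e4 := create_mul_create p h'
  calc create p * create h * (create p' * create h')
      = create p * (create h * create p') * create h' := by noncomm_ring
    _ = -(create p * create p') * (create h * create h') := by rw [e1]; noncomm_ring
    _ = -(create p' * (create p * create h') * create h) := by rw [e2, e3]; noncomm_ring
    _ = _ := by rw [e4]; noncomm_ring

/-! ### Moments of the number operator and a Schur test -/

/-- The quadratic form `⟨ψ, f(𝒩) ψ⟩`, as an extended nonnegative number: no domain question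
arises for unbounded `f`. -/
def numberMoment (f : ℕ → ENNReal) (ψ : Fock) : ENNReal := ∑' S, f S.card * ‖ψ S‖ₑ ^ 2

theorem numberMoment_one (ψ : Fock) : numberMoment (fun _ => 1) ψ = ‖ψ‖ₑ ^ 2 := by
  have h := lp.norm_rpow_eq_tsum (p := 2) (by norm_num) ψ
  simp only [ENNReal.toReal_ofNat, Real.rpow_ofNat] at h
  have hs : Summable (fun S => ‖ψ S‖ ^ 2) := by
    have h := (lp.memℓp ψ).summable (by norm_num)
    simpa using h
  have h1 : ‖ψ‖ₑ ^ 2 = ENNReal.ofReal (‖ψ‖ ^ 2) := by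
    rw [ENNReal.ofReal_pow (norm_nonneg _), ofReal_norm]
  rw [h1, h, ENNReal.ofReal_tsum_of_nonneg (fun _ => by positivity) hs]
  simp only [numberMoment, one_mul]
  refine tsum_congr fun S => ?_
  rw [ENNReal.ofReal_pow (norm_nonneg _), ofReal_norm]

theorem numberMoment_mono {f g : ℕ → ENNReal} (h : ∀ n, f n ≤ g n) (ψ : Fock) :
    numberMoment f ψ ≤ numberMoment g ψ :=
  ENNReal.tsum_le_tsum fun _ => by gcongr; exact h _

theorem numberMoment_const_mul (c : ENNReal) (f : ℕ → ENNReal) (ψ : Fock) :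
    numberMoment (fun n => c * f n) ψ = c * numberMoment f ψ := by
  simp only [numberMoment, mul_assoc, ENNReal.tsum_mul_left]

theorem norm_le_of_numberMoment_le {ψ : Fock} {r : ℝ} (hr : 0 ≤ r)
    (h : numberMoment (fun _ => 1) ψ ≤ ENNReal.ofReal (r ^ 2)) : ‖ψ‖ ≤ r := by
  rw [numberMoment_one, ← ofReal_norm, ← ENNReal.ofReal_pow (norm_nonneg _),
    ENNReal.ofReal_le_ofReal_iff (by positivity)] at h
  exact le_of_sq_le_sq h hr

theorem enorm_sum_sq_le {ι : Type*} (I : Finset ι) (z : ι → ℂ) :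
    ‖∑ i ∈ I, z i‖ₑ ^ 2 ≤ I.card * ∑ i ∈ I, ‖z i‖ₑ ^ 2 := by
  have h : ‖∑ i ∈ I, z i‖ ^ 2 ≤ I.card * ∑ i ∈ I, ‖z i‖ ^ 2 :=
    (pow_le_pow_left₀ (norm_nonneg _) (norm_sum_le _ _) 2).trans sq_sum_le_card_mul_sum_sq
  have h2 := ENNReal.ofReal_le_ofReal h
  rw [ENNReal.ofReal_mul (by positivity), ENNReal.ofReal_natCast,
    ENNReal.ofReal_sum_of_nonneg (fun _ _ => by positivity)] at h2
  simpa only [ENNReal.ofReal_pow (norm_nonneg _), ofReal_norm] using h2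

/-- Schur test for an operator that is a finite sum of "moves" `ψ ↦ (S ↦ c i S * ψ (mv i S))`,
the `i`-th one being active only on the configurations with `p i S`. If at most `a` moves are active
at each configuration and at most `b` moves lead to each configuration, the squared norm of the
operator is at most `D² a b`; the weights are carried along. -/
theorem schur_moves {ι : Type*} (I : Finset ι) (c : ι → Finset Mode → ℂ)
    (mv : ι → Finset Mode → Finset Mode) (p q : ι → Finset Mode → Prop)
    [∀ i S, Decidable (p i S)] [∀ i S, Decidable (q i S)]
    (D : ENNReal) (a : Finset Mode → ENNReal) (b w W : Finset Mode → ENNReal)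
    (hc0 : ∀ i ∈ I, ∀ S, ¬ p i S → c i S = 0) (hcD : ∀ i ∈ I, ∀ S, ‖c i S‖ₑ ≤ D)
    (hinj : ∀ i ∈ I, ∀ S S', p i S → p i S' → mv i S = mv i S' → S = S')
    (ha : ∀ S, (((I.filter fun i => p i S).card : ℕ) : ENNReal) ≤ a S)
    (hW : ∀ i ∈ I, ∀ S, p i S → w S * a S ≤ W (mv i S))
    (hq : ∀ i ∈ I, ∀ S, p i S → q i (mv i S))
    (hb : ∀ S, (((I.filter fun i => q i S).card : ℕ) : ENNReal) ≤ b S)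
    (ψ φ : Fock) (hφ : ∀ S, φ S = ∑ i ∈ I, c i S * ψ (mv i S)) :
    ∑' S, w S * ‖φ S‖ₑ ^ 2 ≤ D ^ 2 * ∑' S, W S * b S * ‖ψ S‖ₑ ^ 2 := by
  have step1 : ∀ S, w S * ‖φ S‖ₑ ^ 2 ≤
      ∑ i ∈ I, if p i S then D ^ 2 * (W (mv i S) * ‖ψ (mv i S)‖ₑ ^ 2) else 0 := by
    intro S
    have h1 : φ S = ∑ i ∈ I.filter (fun i => p i S), c i S * ψ (mv i S) := by
      rw [hφ, Finset.sum_filter]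
      refine Finset.sum_congr rfl fun i hi => ?_
      split_ifs with h
      · rfl
      · rw [hc0 i hi S h, zero_mul]
    calc w S * ‖φ S‖ₑ ^ 2
        ≤ w S * (a S * ∑ i ∈ I.filter (fun i => p i S), ‖c i S * ψ (mv i S)‖ₑ ^ 2) := by
          rw [h1]
          gcongr
          refine (enorm_sum_sq_le _ _).trans ?_
          gcongr
          exact ha S
      _ = ∑ i ∈ I.filter (fun i => p i S), w S * a S * ‖c i S * ψ (mv i S)‖ₑ ^ 2 := by
          rw [← mul_assoc, Finset.mul_sum]
      _ ≤ ∑ i ∈ I.filter (fun i => p i S), D ^ 2 * (W (mv i S) * ‖ψ (mv i S)‖ₑ ^ 2) := by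
          refine Finset.sum_le_sum fun i hi => ?_
          obtain ⟨hi, hp⟩ := Finset.mem_filter.mp hi
          rw [enorm_mul, mul_pow]
          calc w S * a S * (‖c i S‖ₑ ^ 2 * ‖ψ (mv i S)‖ₑ ^ 2)
              ≤ W (mv i S) * (D ^ 2 * ‖ψ (mv i S)‖ₑ ^ 2) := by
                gcongr
                · exact hW i hi S hp
                · exact hcD i hi S
            _ = _ := by ring
      _ = _ := by rw [Finset.sum_filter]
  calc ∑' S, w S * ‖φ S‖ₑ ^ 2
      ≤ ∑' S, ∑ i ∈ I, if p i S then D ^ 2 * (W (mv i S) * ‖ψ (mv i S)‖ₑ ^ 2) else 0 :=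
        ENNReal.tsum_le_tsum step1
    _ = ∑ i ∈ I, ∑' S, if p i S then D ^ 2 * (W (mv i S) * ‖ψ (mv i S)‖ₑ ^ 2) else 0 :=
        Summable.tsum_finsetSum fun _ _ => ENNReal.summable
    _ ≤ ∑ i ∈ I, ∑' S, if q i S then D ^ 2 * (W S * ‖ψ S‖ₑ ^ 2) else 0 := by
        refine Finset.sum_le_sum fun i hi => ?_
        have h2 : ∑' S, (if p i S then D ^ 2 * (W (mv i S) * ‖ψ (mv i S)‖ₑ ^ 2) else 0) =
            ∑' S : {S // p i S}, D ^ 2 * (W (mv i S) * ‖ψ (mv i S)‖ₑ ^ 2) := by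
          refine Eq.trans (tsum_congr fun S => ?_) (tsum_subtype {S | p i S}
            fun S => D ^ 2 * (W (mv i S) * ‖ψ (mv i S)‖ₑ ^ 2)).symm
          simp [Set.indicator_apply]
        rw [h2]
        have hinj' : Function.Injective fun S : {S // p i S} => mv i S := by
          intro S S' h
          exact Subtype.ext (hinj i hi S S' S.2 S'.2 h)
        refine le_trans (ENNReal.tsum_le_tsum fun S => ?_)
          (ENNReal.tsum_comp_le_tsum_of_injective hinj'
            fun S => if q i S then D ^ 2 * (W S * ‖ψ S‖ₑ ^ 2) else 0)
        rw [if_pos (hq i hi S S.2)]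
    _ = ∑' S, ∑ i ∈ I, if q i S then D ^ 2 * (W S * ‖ψ S‖ₑ ^ 2) else 0 :=
        (Summable.tsum_finsetSum fun _ _ => ENNReal.summable).symm
    _ ≤ ∑' S, D ^ 2 * (W S * b S * ‖ψ S‖ₑ ^ 2) := by
        refine ENNReal.tsum_le_tsum fun S => ?_
        rw [← Finset.sum_filter, Finset.sum_const, nsmul_eq_mul]
        calc (((I.filter fun i => q i S).card : ℕ) : ENNReal) * (D ^ 2 * (W S * ‖ψ S‖ₑ ^ 2))
            ≤ b S * (D ^ 2 * (W S * ‖ψ S‖ₑ ^ 2)) := by gcongr; exact hb S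
          _ = _ := by ring
    _ = _ := ENNReal.tsum_mul_left

/-! ### Weighted pair operators -/

theorem mem_fermiBall {kF : ℝ} {h : Mode} : h ∈ fermiBall kF ↔ ‖vec h‖ ≤ kF := by
  simp [fermiBall]

theorem mem_lune {kF : ℝ} {k h : Mode} :
    h ∈ lune kF k ↔ h ∈ fermiBall kF ∧ h + k ∉ fermiBall kF := Finset.mem_filter

/-- The normalized pair creation operator
`n_k⁻¹ ∑_{p ∈ B_F^c, h ∈ B_F} δ_{p,h+k} g(h) a*_p a*_h` with a weight `g`. -/
def weightedPair (kF : ℝ) (g : Mode → ℝ) (k : Mode) : Fock →L[ℂ] Fock :=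
  ((pairNorm kF k : ℂ)⁻¹) • ∑ h ∈ lune kF k, (g h : ℂ) • (create (h + k) * create h)

theorem bStar_eq_weightedPair (kF : ℝ) (k : Mode) :
    bStar kF k = weightedPair kF (fun _ => 1) k := by
  simp [bStar, weightedPair, pairCreate]

theorem star_weightedPair (kF : ℝ) (g : Mode → ℝ) (k : Mode) :
    star (weightedPair kF g k) = ((pairNorm kF k : ℂ)⁻¹) •
      ∑ h ∈ lune kF k, (g h : ℂ) • (annihilate h * annihilate (h + k)) := by
  simp only [weightedPair, star_smul, star_sum, star_mul, star_create]
  simp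

theorem hole_ne_particle {kF : ℝ} {k l h h' : Mode} (hh : h ∈ lune kF k) (hh' : h' ∈ lune kF l) :
    h ≠ h' + l := by
  rintro rfl
  exact (mem_lune.mp hh').2 (mem_lune.mp hh).1

theorem create_mul_create_apply {p h : Mode} (ψ : Fock) (S : Finset Mode) :
    (create p * create h) ψ S = if p ∈ S ∧ h ∈ S.erase p then
      jwSign p (S.erase p) * jwSign h ((S.erase p).erase h) * ψ ((S.erase p).erase h) else 0 := by
  rw [mul_apply_eq_comp, create_apply, create_apply]
  by_cases h1 : p ∈ S <;> by_cases h2 : h ∈ S.erase p <;> simp only [h1, h2, if_true, if_false,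
    and_true, and_false, mul_zero, mul_assoc]

theorem annihilate_mul_annihilate_apply {p h : Mode} (ψ : Fock) (S : Finset Mode) :
    (annihilate h * annihilate p) ψ S = if h ∉ S ∧ p ∉ insert h S then
      jwSign h S * jwSign p (insert h S) * ψ (insert p (insert h S)) else 0 := by
  rw [mul_apply_eq_comp, annihilate_apply, annihilate_apply]
  by_cases h1 : h ∈ S <;> by_cases h2 : p ∈ insert h S <;> simp only [h1, h2, if_true, if_false,
    and_true, and_false, mul_zero, mul_assoc, not_true, not_false_iff]

theorem create_mul_annihilate_apply {x y : Mode} (ψ : Fock) (S : Finset Mode) :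
    (create y * annihilate x) ψ S = if y ∈ S ∧ x ∉ S.erase y then
      jwSign y (S.erase y) * jwSign x (S.erase y) * ψ (insert x (S.erase y)) else 0 := by
  rw [mul_apply_eq_comp, create_apply, annihilate_apply]
  by_cases h1 : y ∈ S <;> by_cases h2 : x ∈ S.erase y <;> simp only [h1, h2, if_true, if_false,
    and_true, and_false, mul_zero, mul_assoc, not_true, not_false_iff]

theorem enorm_jwSign (p : Mode) (S : Finset Mode) : ‖jwSign p S‖ₑ = 1 := by
  rw [← ofReal_norm, norm_jwSign, ENNReal.ofReal_one]

/-- A configuration contains at most half as many pairs `(h + k, h)` as it has elements. -/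
theorem two_mul_card_pairs_le (kF : ℝ) (k : Mode) (S : Finset Mode) :
    2 * ((lune kF k).filter fun h => h ∈ S ∧ h + k ∈ S).card ≤ S.card := by
  set A := (lune kF k).filter fun h => h ∈ S ∧ h + k ∈ S
  have hd : Disjoint A (A.image (· + k)) := by
    rw [Finset.disjoint_left]
    intro x hx hx'
    obtain ⟨y, hy, rfl⟩ := Finset.mem_image.mp hx'
    exact hole_ne_particle (Finset.mem_filter.mp hx).1 (Finset.mem_filter.mp hy).1 rfl
  have hc : (A.image (· + k)).card = A.card :=
    Finset.card_image_of_injective _ (add_left_injective k)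
  have hs : A ∪ A.image (· + k) ⊆ S := by
    intro x hx
    rcases Finset.mem_union.mp hx with hx | hx
    · exact (Finset.mem_filter.mp hx).2.1
    · obtain ⟨y, hy, rfl⟩ := Finset.mem_image.mp hx
      exact (Finset.mem_filter.mp hy).2.2
  have := Finset.card_le_card hs
  rw [Finset.card_union_of_disjoint hd, hc] at this
  omega

theorem card_pairs_le (kF : ℝ) (k : Mode) (S : Finset Mode) :
    ((((lune kF k).filter fun h => h ∈ S ∧ h + k ∈ S).card : ℕ) : ENNReal) ≤ S.card / 2 := by
  rw [ENNReal.le_div_iff_mul_le (by simp) (by simp)]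
  have := two_mul_card_pairs_le kF k S
  rw [mul_comm] at this
  exact_mod_cast this

/-- The square of `n_k` is the number of pairs with relative momentum `k`. -/
theorem pairNorm_sq (kF : ℝ) (k : Mode) : pairNorm kF k ^ 2 = (lune kF k).card := by
  have h1 : (((pairNorm kF k) ^ 2 : ℝ) : ℂ) =
      inner ℂ vacuum ((star (pairCreate kF k) * pairCreate kF k) vacuum) := by
    rw [mul_apply_eq_comp, ContinuousLinearMap.star_eq_adjoint,
      ContinuousLinearMap.adjoint_inner_right, inner_self_eq_norm_sq_to_K, pairNorm]
    simp
  have hv : inner ℂ vacuum vacuum = (1 : ℂ) := by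
    rw [inner_self_eq_norm_sq_to_K, vacuum, lp.norm_single (by norm_num)]; simp
  have h2 : (star (pairCreate kF k) * pairCreate kF k) vacuum = ((lune kF k).card : ℂ) • vacuum := by
    simp only [pairCreate, star_sum, star_mul, star_create, Finset.sum_mul_sum,
      sum_apply]
    have : ∀ h ∈ lune kF k, ∀ h' ∈ lune kF k,
        (annihilate h * annihilate (h + k) * (create (h' + k) * create h')) vacuum =
          if h = h' then vacuum else 0 := by
      intro h hh h' hh'
      have e := pair_commutator (hole_ne_particle hh hh') (hole_ne_particle hh' hh).symm
      have e2 := congrArg (fun A : Fock →L[ℂ] Fock => A vacuum) e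
      simp only [sub_apply, mul_apply_eq_comp, annihilate_vacuum, map_zero, sub_zero] at e2 ⊢
      rw [e2]
      by_cases hhh : h = h'
      · subst hhh; simp [annihilate_vacuum]
      · simp [hhh]
    rw [Finset.sum_congr rfl fun h hh => Finset.sum_congr rfl (this h hh)]
    simp only [Finset.sum_ite_eq]
    rw [Finset.sum_congr rfl fun h hh => if_pos hh, Finset.sum_const, Nat.cast_smul_eq_nsmul]
  rw [h2, inner_smul_right, hv, mul_one] at h1
  exact_mod_cast h1

theorem pairNorm_nonneg (kF : ℝ) (k : Mode) : 0 ≤ pairNorm kF k := norm_nonneg _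

theorem enorm_inv_pairNorm_sq_mul_le (kF : ℝ) (k : Mode) :
    ‖((pairNorm kF k : ℂ)⁻¹)‖ₑ ^ 2 * (lune kF k).card ≤ 1 := by
  rw [← ofReal_norm, ← ENNReal.ofReal_pow (norm_nonneg _), ← ENNReal.ofReal_natCast,
    ← ENNReal.ofReal_mul (by positivity), ← pairNorm_sq]
  rw [ENNReal.ofReal_le_one, norm_inv, Complex.norm_real, Real.norm_eq_abs,
    abs_of_nonneg (pairNorm_nonneg _ _), inv_pow]
  exact inv_mul_le_one

/-- `b*_k` is bounded by `(𝒩/2 + 1)^{1/2}`, with number weights. -/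
theorem numberMoment_bStar_le (kF : ℝ) (k : Mode) (f : ℕ → ENNReal) (ψ : Fock) :
    numberMoment f (bStar kF k ψ) ≤
      numberMoment (fun n => f (n + 2) * (((n + 2 : ℕ) : ENNReal) / 2)) ψ := by
  have key := schur_moves (lune kF k)
    (fun h S => if h + k ∈ S ∧ h ∈ S.erase (h + k) then (pairNorm kF k : ℂ)⁻¹ *
      (jwSign (h + k) (S.erase (h + k)) * jwSign h ((S.erase (h + k)).erase h)) else 0)
    (fun h S => (S.erase (h + k)).erase h)
    (fun h S => h ∈ S ∧ h + k ∈ S) (fun _ _ => True) ‖((pairNorm kF k : ℂ)⁻¹)‖ₑ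
    (fun S => (S.card : ENNReal) / 2) (fun _ => ((lune kF k).card : ENNReal))
    (fun S => f S.card) (fun S => f (S.card + 2) * (((S.card + 2 : ℕ) : ENNReal) / 2))
    ?_ ?_ ?_ ?_ ?_ ?_ ?_ ψ (bStar kF k ψ) ?_
  · refine key.trans ?_
    rw [← ENNReal.tsum_mul_left]
    refine ENNReal.tsum_le_tsum fun S => ?_
    calc ‖((pairNorm kF k : ℂ)⁻¹)‖ₑ ^ 2 * (f (S.card + 2) * (((S.card + 2 : ℕ) : ENNReal) / 2) *
          ((lune kF k).card : ENNReal) * ‖ψ S‖ₑ ^ 2)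
        = (‖((pairNorm kF k : ℂ)⁻¹)‖ₑ ^ 2 * (lune kF k).card) *
          (f (S.card + 2) * (((S.card + 2 : ℕ) : ENNReal) / 2) * ‖ψ S‖ₑ ^ 2) := by ring
      _ ≤ 1 * (f (S.card + 2) * (((S.card + 2 : ℕ) : ENNReal) / 2) * ‖ψ S‖ₑ ^ 2) := by
          gcongr
          exact enorm_inv_pairNorm_sq_mul_le kF k
      _ = _ := one_mul _
  · intro h _ S hp
    rw [if_neg]
    rintro ⟨h1, h2⟩
    exact hp ⟨Finset.mem_of_mem_erase h2, h1⟩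
  · intro h _ S
    split_ifs
    · simp [enorm_mul, enorm_jwSign]
    · simp
  · intro h hh S S' hp hp' he
    have hne : h ≠ h + k := hole_ne_particle hh hh
    rw [← Finset.insert_erase hp.2, ← Finset.insert_erase hp'.2,
      ← Finset.insert_erase (Finset.mem_erase.mpr ⟨hne, hp.1⟩),
      ← Finset.insert_erase (Finset.mem_erase.mpr ⟨hne, hp'.1⟩), he]
  · intro S
    exact card_pairs_le kF k S
  · intro h hh S hp
    have hne : h ≠ h + k := hole_ne_particle hh hh
    have hc : ((S.erase (h + k)).erase h).card + 2 = S.card := by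
      rw [← Finset.card_erase_add_one hp.2,
        ← Finset.card_erase_add_one (Finset.mem_erase.mpr ⟨hne, hp.1⟩)]
    rw [hc]
  · intros; trivial
  · intro S; simp
  · intro S
    rw [bStar_eq_weightedPair, weightedPair, smul_apply, sum_apply, lp.coeFn_smul, Pi.smul_apply,
      lp.coeFn_sum, Finset.sum_apply, Finset.smul_sum]
    refine Finset.sum_congr rfl fun h _ => ?_
    rw [Complex.ofReal_one, one_smul, create_mul_create_apply]
    split_ifs <;> simp [mul_assoc]

/-- `b_k` is bounded by `(𝒩/2)^{1/2}`, with number weights. -/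
theorem numberMoment_star_bStar_le (kF : ℝ) (k : Mode) (f : ℕ → ENNReal) (ψ : Fock) :
    numberMoment f (star (bStar kF k) ψ) ≤
      numberMoment (fun n => f (n - 2) * ((n : ENNReal) / 2)) ψ := by
  have key := schur_moves (lune kF k)
    (fun h S => if h ∉ S ∧ h + k ∉ insert h S then (pairNorm kF k : ℂ)⁻¹ *
      (jwSign h S * jwSign (h + k) (insert h S)) else 0)
    (fun h S => insert (h + k) (insert h S))
    (fun h S => h ∉ S ∧ h + k ∉ S) (fun h S => h ∈ S ∧ h + k ∈ S) ‖((pairNorm kF k : ℂ)⁻¹)‖ₑ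
    (fun _ => ((lune kF k).card : ENNReal)) (fun S => (S.card : ENNReal) / 2)
    (fun S => f S.card) (fun S => f (S.card - 2) * ((lune kF k).card : ENNReal))
    ?_ ?_ ?_ ?_ ?_ ?_ ?_ ψ (star (bStar kF k) ψ) ?_
  · refine key.trans ?_
    rw [← ENNReal.tsum_mul_left]
    refine ENNReal.tsum_le_tsum fun S => ?_
    calc ‖((pairNorm kF k : ℂ)⁻¹)‖ₑ ^ 2 * (f (S.card - 2) * ((lune kF k).card : ENNReal) *
          ((S.card : ENNReal) / 2) * ‖ψ S‖ₑ ^ 2)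
        = (‖((pairNorm kF k : ℂ)⁻¹)‖ₑ ^ 2 * (lune kF k).card) *
          (f (S.card - 2) * ((S.card : ENNReal) / 2) * ‖ψ S‖ₑ ^ 2) := by ring
      _ ≤ 1 * (f (S.card - 2) * ((S.card : ENNReal) / 2) * ‖ψ S‖ₑ ^ 2) := by
          gcongr
          exact enorm_inv_pairNorm_sq_mul_le kF k
      _ = _ := one_mul _
  · intro h _ S hp
    rw [if_neg]
    rintro ⟨h1, h2⟩
    exact hp ⟨h1, fun h3 => h2 (Finset.mem_insert_of_mem h3)⟩
  · intro h _ S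
    split_ifs
    · simp [enorm_mul, enorm_jwSign]
    · simp
  · intro h hh S S' hp hp' he
    have hne : h ≠ h + k := hole_ne_particle hh hh
    have e : ∀ S : Finset Mode, h ∉ S ∧ h + k ∉ S →
        ((insert (h + k) (insert h S)).erase (h + k)).erase h = S := by
      intro S hS
      rw [Finset.erase_insert (by simp [hS.2, hne.symm]), Finset.erase_insert hS.1]
    rw [← e S hp, ← e S' hp', he]
  · intro S
    exact_mod_cast Finset.card_filter_le _ _
  · intro h hh S hp
    have hne : h ≠ h + k := hole_ne_particle hh hh
    rw [Finset.card_insert_of_notMem (by simp [hp.2, hne.symm]),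
      Finset.card_insert_of_notMem hp.1]
    simp
  · intro h _ S _; simp
  · intro S
    exact card_pairs_le kF k S
  · intro S
    rw [bStar_eq_weightedPair, star_weightedPair, smul_apply, sum_apply, lp.coeFn_smul,
      Pi.smul_apply, lp.coeFn_sum, Finset.sum_apply, Finset.smul_sum]
    refine Finset.sum_congr rfl fun h _ => ?_
    rw [Complex.ofReal_one, one_smul, annihilate_mul_annihilate_apply]
    split_ifs <;> simp [mul_assoc]

/-- One-body hopping operators with injective sources and targets are bounded by `𝒩`, with number
weights. -/
theorem numberMoment_hopping_le {ι : Type*} (I : Finset ι) (c : ι → ℂ) (x y : ι → Mode)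
    (hx : Set.InjOn x I) (hy : Set.InjOn y I) (D : ENNReal) (hD : ∀ i ∈ I, ‖c i‖ₑ ≤ D)
    (f : ℕ → ENNReal) (ψ : Fock) :
    numberMoment f ((∑ i ∈ I, c i • (create (y i) * annihilate (x i))) ψ) ≤
      D ^ 2 * numberMoment (fun n => f n * (n : ENNReal) ^ 2) ψ := by
  have hcard : ∀ (z : ι → Mode), Set.InjOn z I → ∀ S : Finset Mode,
      ((I.filter fun i => z i ∈ S).card : ENNReal) ≤ S.card := by
    intro z hz S
    have : (I.filter fun i => z i ∈ S).card ≤ S.card :=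
      Finset.card_le_card_of_injOn z (fun i hi => (Finset.mem_filter.mp hi).2)
        (hz.mono fun i hi => (Finset.mem_filter.mp hi).1)
    exact_mod_cast this
  have key := schur_moves I
    (fun i S => if y i ∈ S ∧ x i ∉ S.erase (y i) then c i *
      (jwSign (y i) (S.erase (y i)) * jwSign (x i) (S.erase (y i))) else 0)
    (fun i S => insert (x i) (S.erase (y i)))
    (fun i S => y i ∈ S ∧ x i ∉ S.erase (y i)) (fun i S => x i ∈ S) D
    (fun S => (S.card : ENNReal)) (fun S => (S.card : ENNReal))
    (fun S => f S.card) (fun S => f S.card * S.card)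
    ?_ ?_ ?_ ?_ ?_ ?_ ?_ ψ ((∑ i ∈ I, c i • (create (y i) * annihilate (x i))) ψ) ?_
  · refine key.trans (le_of_eq ?_)
    congr 1
    refine tsum_congr fun S => ?_
    ring
  · intro i _ S hp
    rw [if_neg hp]
  · intro i hi S
    split_ifs
    · simpa [enorm_mul, enorm_jwSign] using hD i hi
    · simp
  · intro i _ S S' hp hp' he
    rw [← Finset.insert_erase hp.1, ← Finset.insert_erase hp'.1, ← Finset.erase_insert hp.2,
      ← Finset.erase_insert hp'.2, he]
  · intro S
    refine le_trans ?_ (hcard y hy S)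
    exact_mod_cast Finset.card_le_card
      (Finset.monotone_filter_right I fun i _ (h : y i ∈ S ∧ x i ∉ S.erase (y i)) => h.1)
  · intro i _ S hp
    rw [Finset.card_insert_of_notMem hp.2, Finset.card_erase_add_one hp.1]
  · intro i _ S _; simp
  · exact hcard x hx
  · intro S
    rw [sum_apply, lp.coeFn_sum, Finset.sum_apply]
    refine Finset.sum_congr rfl fun i _ => ?_
    rw [smul_apply, lp.coeFn_smul, Pi.smul_apply, create_mul_annihilate_apply]
    split_ifs <;> simp [mul_assoc]

/-! ### Almost-bosonic commutation relations -/

/-- The mean `n_k⁻² ∑_{h} g(h)` of a weight over the pairs with relative momentum `k`. -/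
def pairMean (kF : ℝ) (g : Mode → ℝ) (k : Mode) : ℝ :=
  (pairNorm kF k ^ 2)⁻¹ * ∑ h ∈ lune kF k, g h

/-- The deviation of `[c, b*_l]` from its bosonic value, where `c` is the annihilator adjoint to
`weightedPair kF g k`. -/
def commDefect (kF : ℝ) (g : Mode → ℝ) (k l : Mode) : Fock →L[ℂ] Fock :=
  star (weightedPair kF g k) * bStar kF l - bStar kF l * star (weightedPair kF g k)
    - (if k = l then (pairMean kF g k : ℂ) else 0) • 1

/-- The defect is a sum of one-body hops: hole hops `h → h + k - l`, from pairs sharing their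
particle, and particle hops `h + k → h + l`, from pairs sharing their hole. -/
theorem commDefect_eq (kF : ℝ) (g : Mode → ℝ) (k l : Mode) :
    commDefect kF g k l = -∑ i ∈ ((lune kF k).filter fun h => h + k - l ∈ lune kF l).disjSum
        (lune kF k ∩ lune kF l),
      (Sum.elim (fun h => ((g h / (pairNorm kF k * pairNorm kF l) : ℝ) : ℂ))
        (fun h => ((g h / (pairNorm kF k * pairNorm kF l) : ℝ) : ℂ)) i) •
      (create (Sum.elim (fun h => h + k - l) (fun h => h + l) i) *
        annihilate (Sum.elim (fun h => h) (fun h => h + k) i)) := by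
  have hcomm : star (weightedPair kF g k) * bStar kF l - bStar kF l * star (weightedPair kF g k) =
      ∑ h ∈ lune kF k, ∑ h' ∈ lune kF l, ((g h / (pairNorm kF k * pairNorm kF l) : ℝ) : ℂ) •
        ((if h + k = h' + l then 1 else 0) * (if h = h' then 1 else 0)
        - (if h + k = h' + l then create h' * annihilate h else 0)
        - (if h = h' then create (h' + l) * annihilate (h + k) else 0)) := by
    rw [bStar, pairCreate, star_weightedPair]
    simp only [smul_mul_smul_comm, Finset.sum_mul_sum]
    rw [Finset.sum_comm (s := lune kF l) (t := lune kF k), mul_comm (pairNorm kF l : ℂ)⁻¹,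
      ← smul_sub, ← Finset.sum_sub_distrib, Finset.smul_sum]
    refine Finset.sum_congr rfl fun h hh => ?_
    rw [← Finset.sum_sub_distrib, Finset.smul_sum]
    refine Finset.sum_congr rfl fun h' hh' => ?_
    rw [← pair_commutator (hole_ne_particle hh hh') (hole_ne_particle hh' hh).symm,
      smul_mul_assoc, mul_smul_comm, ← smul_sub, smul_smul]
    congr 1
    push_cast
    field_simp
  have h1 : ∑ h ∈ lune kF k, ∑ h' ∈ lune kF l,
      ((g h / (pairNorm kF k * pairNorm kF l) : ℝ) : ℂ) •
        ((if h + k = h' + l then 1 else 0) * (if h = h' then 1 else 0) : Fock →L[ℂ] Fock) =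
      (if k = l then (pairMean kF g k : ℂ) else 0) • 1 := by
    by_cases hkl : k = l
    · subst hkl
      simp only [if_true, add_left_inj, mul_ite, mul_one, mul_zero]
      have : ∀ h ∈ lune kF k, ∑ h' ∈ lune kF k,
          ((g h / (pairNorm kF k * pairNorm kF k) : ℝ) : ℂ) •
            (if h = h' then (if h = h' then 1 else 0) else 0 : Fock →L[ℂ] Fock) =
          ((g h / (pairNorm kF k * pairNorm kF k) : ℝ) : ℂ) • 1 := by
        intro h hh
        rw [Finset.sum_eq_single_of_mem h hh]
        · simp
        · intro b _ hb
          simp [hb.symm]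
      rw [Finset.sum_congr rfl this, ← Finset.sum_smul, pairMean, Finset.mul_sum]
      push_cast
      congr 1
      refine Finset.sum_congr rfl fun h _ => ?_
      rw [div_eq_inv_mul, sq]
    · rw [if_neg hkl, zero_smul]
      refine Finset.sum_eq_zero fun h _ => Finset.sum_eq_zero fun h' _ => ?_
      by_cases hh : h = h'
      · subst hh; simp [hkl]
      · simp [hh]
  have h2 : ∑ h ∈ lune kF k, ∑ h' ∈ lune kF l,
      ((g h / (pairNorm kF k * pairNorm kF l) : ℝ) : ℂ) •
        (if h + k = h' + l then create h' * annihilate h else 0) =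
      ∑ h ∈ (lune kF k).filter fun h => h + k - l ∈ lune kF l,
        ((g h / (pairNorm kF k * pairNorm kF l) : ℝ) : ℂ) •
          (create (h + k - l) * annihilate h) := by
    rw [Finset.sum_filter]
    refine Finset.sum_congr rfl fun h _ => ?_
    simp only [smul_ite, smul_zero, ← sub_eq_iff_eq_add]
    rw [Finset.sum_ite_eq]
  have h3 : ∑ h ∈ lune kF k, ∑ h' ∈ lune kF l,
      ((g h / (pairNorm kF k * pairNorm kF l) : ℝ) : ℂ) •
        (if h = h' then create (h' + l) * annihilate (h + k) else 0) =
      ∑ h ∈ lune kF k ∩ lune kF l, ((g h / (pairNorm kF k * pairNorm kF l) : ℝ) : ℂ) •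
          (create (h + l) * annihilate (h + k)) := by
    rw [← Finset.filter_mem_eq_inter, Finset.sum_filter]
    refine Finset.sum_congr rfl fun h _ => ?_
    simp only [smul_ite, smul_zero]
    rw [Finset.sum_ite_eq]
  rw [commDefect, hcomm, ← h1, Finset.sum_disjSum]
  simp only [Sum.elim_inl, Sum.elim_inr]
  rw [← h2, ← h3, neg_add, ← sub_eq_add_neg]
  simp only [smul_sub, Finset.sum_sub_distrib]
  abel

theorem numberMoment_neg (f : ℕ → ENNReal) (ψ : Fock) :
    numberMoment f (-ψ) = numberMoment f ψ := by
  simp [numberMoment]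

/-- The commutator defect is bounded by `D 𝒩 / (n_k n_l)` for a weight bounded by `D`. -/
theorem numberMoment_commDefect_le {kF : ℝ} {g : Mode → ℝ} {k : Mode} {D : ℝ}
    (hD : ∀ h ∈ lune kF k, |g h| ≤ D) (l : Mode) (f : ℕ → ENNReal) (ψ : Fock) :
    numberMoment f (commDefect kF g k l ψ) ≤
      ENNReal.ofReal (D / (pairNorm kF k * pairNorm kF l)) ^ 2 *
        numberMoment (fun n => f n * (n : ENNReal) ^ 2) ψ := by
  rw [commDefect_eq, neg_apply, numberMoment_neg]
  refine numberMoment_hopping_le _ _ _ _ ?_ ?_ _ ?_ f ψ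
  · rintro (a | a) ha (b | b) hb hab <;>
      simp only [Finset.mem_coe, Finset.inl_mem_disjSum, Finset.inr_mem_disjSum,
        Finset.mem_filter, Finset.mem_inter, Sum.elim_inl, Sum.elim_inr] at ha hb hab
    · rw [hab]
    · exact absurd hab (hole_ne_particle ha.1 hb.1)
    · exact absurd hab.symm (hole_ne_particle hb.1 ha.1)
    · rw [add_right_cancel hab]
  · rintro (a | a) ha (b | b) hb hab <;>
      simp only [Finset.mem_coe, Finset.inl_mem_disjSum, Finset.inr_mem_disjSum,
        Finset.mem_filter, Finset.mem_inter, Sum.elim_inl, Sum.elim_inr] at ha hb hab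
    · rw [add_right_cancel (sub_left_injective hab)]
    · exact absurd hab (hole_ne_particle ha.2 hb.2)
    · exact absurd hab.symm (hole_ne_particle hb.2 ha.2)
    · rw [add_right_cancel hab]
  · have hg : ∀ h ∈ lune kF k, ‖((g h / (pairNorm kF k * pairNorm kF l) : ℝ) : ℂ)‖ₑ ≤
        ENNReal.ofReal (D / (pairNorm kF k * pairNorm kF l)) := by
      intro h hh
      rw [← ofReal_norm]
      refine ENNReal.ofReal_le_ofReal ?_
      have hn := mul_nonneg (pairNorm_nonneg kF k) (pairNorm_nonneg kF l)
      rw [Complex.norm_real, Real.norm_eq_abs, abs_div, abs_of_nonneg hn]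
      exact div_le_div_of_nonneg_right (hD h hh) hn
    rintro (a | a) ha <;>
      simp only [Finset.inl_mem_disjSum, Finset.inr_mem_disjSum,
        Finset.mem_filter, Finset.mem_inter] at ha
    · exact hg a ha.1
    · exact hg a ha.1

/-! ### Third number moments control the commutator defects -/

/-- Passage from number moments to norms. The factor `1/√2` is the gain from counting pairs instead of
particles in the bounds on `b` and `b*`. -/
theorem norm_le_of_numberMoment_le_cube {ψ φ : Fock} {M d : ℝ} (hM : 0 ≤ M) (hd : 0 ≤ d)
    (hψ : numberMoment (fun n => ((n + 2 : ℕ) : ENNReal) ^ 3) ψ ≤ ENNReal.ofReal (M ^ 2))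
    {F : ℕ → ENNReal} (hF : ∀ n, F n ≤ 2⁻¹ * ((n + 2 : ℕ) : ENNReal) ^ 3)
    (h : numberMoment (fun _ => 1) φ ≤ ENNReal.ofReal d ^ 2 * numberMoment F ψ) :
    ‖φ‖ ≤ d * (M / √2) := by
  refine norm_le_of_numberMoment_le (by positivity) (h.trans ?_)
  calc ENNReal.ofReal d ^ 2 * numberMoment F ψ
      ≤ ENNReal.ofReal d ^ 2 * (2⁻¹ * ENNReal.ofReal (M ^ 2)) := by
        gcongr
        refine (numberMoment_mono hF ψ).trans ?_
        rw [numberMoment_const_mul]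
        gcongr
    _ = ENNReal.ofReal ((d * (M / √2)) ^ 2) := by
        have h2 : (2⁻¹ : ENNReal) = ENNReal.ofReal (2⁻¹) := by
          rw [ENNReal.ofReal_inv_of_pos two_pos]; simp
        rw [h2, ← ENNReal.ofReal_mul (by positivity), ← ENNReal.ofReal_pow hd,
          ← ENNReal.ofReal_mul (by positivity)]
        congr 1
        rw [mul_pow, div_pow, Real.sq_sqrt two_pos.le]
        ring

section DefectBounds

variable {kF : ℝ} {g : Mode → ℝ} {k : Mode} {D M : ℝ} {ψ : Fock}

theorem norm_commDefect_bStar_le (hD0 : 0 ≤ D) (hD : ∀ h ∈ lune kF k, |g h| ≤ D) (hM : 0 ≤ M)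
    (hψ : numberMoment (fun n => ((n + 2 : ℕ) : ENNReal) ^ 3) ψ ≤ ENNReal.ofReal (M ^ 2))
    (l l' : Mode) :
    ‖commDefect kF g k l (bStar kF l' ψ)‖ ≤
      D / (pairNorm kF k * pairNorm kF l) * (M / √2) := by
  have hn := mul_nonneg (pairNorm_nonneg kF k) (pairNorm_nonneg kF l)
  refine norm_le_of_numberMoment_le_cube hM (by positivity) hψ (fun n => le_rfl)
    ((numberMoment_commDefect_le hD l _ _).trans ?_)
  gcongr
  refine (numberMoment_bStar_le _ _ _ _).trans (numberMoment_mono (fun n => le_of_eq ?_) _)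
  simp only [ENNReal.div_eq_inv_mul]
  ring

theorem norm_bStar_commDefect_le (hD0 : 0 ≤ D) (hD : ∀ h ∈ lune kF k, |g h| ≤ D) (hM : 0 ≤ M)
    (hψ : numberMoment (fun n => ((n + 2 : ℕ) : ENNReal) ^ 3) ψ ≤ ENNReal.ofReal (M ^ 2))
    (l l' : Mode) :
    ‖bStar kF l' (commDefect kF g k l ψ)‖ ≤
      D / (pairNorm kF k * pairNorm kF l) * (M / √2) := by
  have hn := mul_nonneg (pairNorm_nonneg kF k) (pairNorm_nonneg kF l)
  refine norm_le_of_numberMoment_le_cube hM (by positivity) hψ (fun n => ?_)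
    ((numberMoment_bStar_le _ _ _ _).trans (numberMoment_commDefect_le hD l _ _))
  have : (n : ENNReal) ≤ ((n + 2 : ℕ) : ENNReal) := by exact_mod_cast Nat.le_add_right n 2
  calc 1 * (((n + 2 : ℕ) : ENNReal) / 2) * (n : ENNReal) ^ 2
      ≤ 1 * (((n + 2 : ℕ) : ENNReal) / 2) * ((n + 2 : ℕ) : ENNReal) ^ 2 := by gcongr
    _ = _ := by simp only [ENNReal.div_eq_inv_mul]; ring

theorem norm_commDefect_star_bStar_le (hD0 : 0 ≤ D) (hD : ∀ h ∈ lune kF k, |g h| ≤ D)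
    (hM : 0 ≤ M)
    (hψ : numberMoment (fun n => ((n + 2 : ℕ) : ENNReal) ^ 3) ψ ≤ ENNReal.ofReal (M ^ 2))
    (l l' : Mode) :
    ‖commDefect kF g k l (star (bStar kF l') ψ)‖ ≤
      D / (pairNorm kF k * pairNorm kF l) * (M / √2) := by
  have hn := mul_nonneg (pairNorm_nonneg kF k) (pairNorm_nonneg kF l)
  refine norm_le_of_numberMoment_le_cube hM (by positivity) hψ (fun n => le_rfl)
    ((numberMoment_commDefect_le hD l _ _).trans ?_)
  gcongr
  refine (numberMoment_star_bStar_le _ _ _ _).trans (numberMoment_mono (fun n => ?_) _)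
  have h1 : (n : ENNReal) ≤ ((n + 2 : ℕ) : ENNReal) := by exact_mod_cast Nat.le_add_right n 2
  have h2 : ((n - 2 : ℕ) : ENNReal) ≤ ((n + 2 : ℕ) : ENNReal) := by
    exact_mod_cast (by omega : n - 2 ≤ n + 2)
  calc 1 * ((n - 2 : ℕ) : ENNReal) ^ 2 * ((n : ENNReal) / 2)
      ≤ 1 * ((n + 2 : ℕ) : ENNReal) ^ 2 * (((n + 2 : ℕ) : ENNReal) / 2) := by gcongr
    _ = _ := by simp only [ENNReal.div_eq_inv_mul]; ring

theorem norm_star_bStar_commDefect_le (hD0 : 0 ≤ D) (hD : ∀ h ∈ lune kF k, |g h| ≤ D)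
    (hM : 0 ≤ M)
    (hψ : numberMoment (fun n => ((n + 2 : ℕ) : ENNReal) ^ 3) ψ ≤ ENNReal.ofReal (M ^ 2))
    (l l' : Mode) :
    ‖star (bStar kF l') (commDefect kF g k l ψ)‖ ≤
      D / (pairNorm kF k * pairNorm kF l) * (M / √2) := by
  have hn := mul_nonneg (pairNorm_nonneg kF k) (pairNorm_nonneg kF l)
  refine norm_le_of_numberMoment_le_cube hM (by positivity) hψ (fun n => ?_)
    ((numberMoment_star_bStar_le _ _ _ _).trans (numberMoment_commDefect_le hD l _ _))
  have : (n : ENNReal) ≤ ((n + 2 : ℕ) : ENNReal) := by exact_mod_cast Nat.le_add_right n 2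
  calc 1 * ((n : ENNReal) / 2) * (n : ENNReal) ^ 2
      ≤ 1 * (((n + 2 : ℕ) : ENNReal) / 2) * ((n + 2 : ℕ) : ENNReal) ^ 2 := by gcongr
    _ = _ := by simp only [ENNReal.div_eq_inv_mul]; ring

end DefectBounds

theorem star_commDefect_one (kF : ℝ) (k l : Mode) :
    star (commDefect kF (fun _ => 1) k l) = commDefect kF (fun _ => 1) l k := by
  have hone : ∀ k, star (weightedPair kF (fun _ => 1) k) = star (bStar kF k) := fun k => by
    rw [bStar_eq_weightedPair]
  simp only [commDefect, hone, star_sub, star_mul, star_star, star_smul, star_one]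
  congr 2
  by_cases h : k = l
  · subst h; simp
  · simp [h, Ne.symm h]

/-! ### Geometry of the Fermi ball -/

theorem vec_neg (k : Mode) : vec (-k) = -vec k := by
  ext i; simp [vec]

theorem vec_add (k l : Mode) : vec (k + l) = vec k + vec l := by
  ext i; simp [vec]

theorem neg_mem_fermiBall {kF : ℝ} {h : Mode} : -h ∈ fermiBall kF ↔ h ∈ fermiBall kF := by
  rw [mem_fermiBall, mem_fermiBall, vec_neg, norm_neg]

theorem pairNorm_neg (kF : ℝ) (k : Mode) : pairNorm kF (-k) = pairNorm kF k := by
  refine (sq_eq_sq₀ (pairNorm_nonneg _ _) (pairNorm_nonneg _ _)).mp ?_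
  rw [pairNorm_sq, pairNorm_sq]
  congr 1
  refine Finset.card_bij (fun h _ => -h) ?_ (fun _ _ _ _ h => neg_injective h) ?_
  · intro h hh
    rw [mem_lune] at hh ⊢
    refine ⟨neg_mem_fermiBall.mpr hh.1, fun hc => hh.2 ?_⟩
    rw [← neg_mem_fermiBall]
    convert hc using 1
    abel
  · intro h hh
    refine ⟨-h, ?_, neg_neg h⟩
    rw [mem_lune] at hh ⊢
    refine ⟨neg_mem_fermiBall.mpr hh.1, fun hc => hh.2 ?_⟩
    rw [← neg_mem_fermiBall]
    convert hc using 1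
    abel

/-- A translate of a nonempty finite set by `k ≠ 0` leaves the set, so `n_k ≥ 1`. -/
theorem one_le_pairNorm {kF : ℝ} (hB : (fermiBall kF).Nonempty) {k : Mode} (hk : k ≠ 0) :
    1 ≤ pairNorm kF k := by
  have hl : (lune kF k).Nonempty := by
    by_contra hne
    rw [Finset.not_nonempty_iff_eq_empty] at hne
    have hstep : ∀ h ∈ fermiBall kF, h + k ∈ fermiBall kF := by
      intro h hh
      by_contra hc
      have : h ∈ lune kF k := mem_lune.mpr ⟨hh, hc⟩
      simp [hne] at this
    obtain ⟨h, hh⟩ := hB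
    have hall : ∀ n : ℕ, h + n • k ∈ fermiBall kF := by
      intro n
      induction n with
      | zero => simpa using hh
      | succ n ih => rw [succ_nsmul, ← add_assoc]; exact hstep _ ih
    obtain ⟨i, hi⟩ := Function.ne_iff.mp hk
    refine Set.infinite_of_injective_forall_mem (f := fun n : ℕ => h + n • k) ?_ hall
      (Finset.finite_toSet _)
    intro m n hmn
    have h1 := congrFun (add_left_cancel hmn) i
    simp only [Pi.smul_apply, nsmul_eq_mul] at h1
    exact_mod_cast mul_right_cancel₀ hi h1
  have h1 : (1 : ℝ) ≤ pairNorm kF k ^ 2 := by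
    rw [pairNorm_sq]; exact_mod_cast hl.card_pos
  nlinarith [pairNorm_nonneg kF k]

theorem one_le_norm_vec {k : Mode} (hk : k ≠ 0) : 1 ≤ ‖vec k‖ := by
  obtain ⟨i, hi⟩ := Function.ne_iff.mp hk
  have h1 := PiLp.norm_apply_le (vec k) i
  simp only [vec, Real.norm_eq_abs] at h1
  refine le_trans ?_ h1
  exact_mod_cast Int.one_le_abs hi

theorem pairNorm_le_card {kF : ℝ} (hB : (fermiBall kF).Nonempty) (k : Mode) :
    pairNorm kF k ≤ (fermiBall kF).card := by
  have h1 : pairNorm kF k ^ 2 ≤ (fermiBall kF).card := by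
    rw [pairNorm_sq]; exact_mod_cast Finset.card_filter_le _ _
  have h2 : (1 : ℝ) ≤ (fermiBall kF).card := by exact_mod_cast hB.card_pos
  nlinarith [pairNorm_nonneg kF k]

theorem norm_weightedPair_le {kF : ℝ} (hB : (fermiBall kF).Nonempty) {g : Mode → ℝ} {k : Mode}
    {D : ℝ} (hD0 : 0 ≤ D) (hD : ∀ h ∈ lune kF k, |g h| ≤ D) :
    ‖weightedPair kF g k‖ ≤ D * (fermiBall kF).card := by
  have h1 : ‖∑ h ∈ lune kF k, (g h : ℂ) • (create (h + k) * create h)‖ ≤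
      pairNorm kF k ^ 2 * D := by
    rw [pairNorm_sq, ← nsmul_eq_mul]
    refine norm_sum_le_of_le (lune kF k) (f := fun h => (g h : ℂ) • (create (h + k) * create h))
      (n := fun _ => D) (fun h hh => ?_) |>.trans (by simp)
    rw [norm_smul, Complex.norm_real, Real.norm_eq_abs]
    calc |g h| * ‖create (h + k) * create h‖ ≤ D * (1 * 1) := by
          gcongr
          · exact hD h hh
          · refine (norm_mul_le _ _).trans ?_
            gcongr <;> exact norm_create_le _
      _ = D := by ring
  rw [weightedPair, norm_smul, norm_inv, Complex.norm_real, Real.norm_eq_abs,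
    abs_of_nonneg (pairNorm_nonneg _ _)]
  calc (pairNorm kF k)⁻¹ * _ ≤ (pairNorm kF k)⁻¹ * (pairNorm kF k ^ 2 * D) := by
        gcongr
        exact inv_nonneg.mpr (pairNorm_nonneg _ _)
    _ = pairNorm kF k * D := by
        by_cases h0 : pairNorm kF k = 0
        · simp [h0]
        · field_simp
    _ ≤ _ := by rw [mul_comm]; gcongr; exact pairNorm_le_card hB k

theorem norm_bStar_le {kF : ℝ} (hB : (fermiBall kF).Nonempty) (k : Mode) :
    ‖bStar kF k‖ ≤ (fermiBall kF).card := by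
  rw [bStar_eq_weightedPair]
  simpa using norm_weightedPair_le hB (k := k) (g := fun _ => 1) zero_le_one (by simp)

/-! ### The generator and its commutators with pair operators -/

theorem weightedPair_commute (kF : ℝ) (g g' : Mode → ℝ) (k l : Mode) :
    Commute (weightedPair kF g k) (weightedPair kF g' l) := by
  unfold weightedPair
  refine Commute.smul_left (Commute.smul_right ?_ _) _
  refine Commute.sum_left _ _ _ fun h _ => Commute.sum_right _ _ _ fun h' _ => ?_
  exact Commute.smul_left (Commute.smul_right (create_pair_comm _ _ _ _) _) _

theorem weightedPair_commute_bStar (kF : ℝ) (g : Mode → ℝ) (k l : Mode) :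
    Commute (weightedPair kF g k) (bStar kF l) := by
  rw [bStar_eq_weightedPair]; exact weightedPair_commute _ _ _ _ _

section Generator

variable {kF : ℝ} {Ξ : Mode → ℂ}

theorem summable_bogCreate (hB : (fermiBall kF).Nonempty)
    (hΞ : Summable fun k : NZ => ‖Ξ k.1‖) :
    Summable (fun k : NZ => Ξ k.1 • (bStar kF k.1 * bStar kF (-k.1))) := by
  refine Summable.of_norm_bounded
    (hΞ.mul_right (((fermiBall kF).card : ℝ) * (fermiBall kF).card)) fun k => ?_
  rw [norm_smul]
  gcongr
  refine (norm_mul_le _ _).trans ?_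
  gcongr <;> exact norm_bStar_le hB _

theorem hasSum_bogCreate (hB : (fermiBall kF).Nonempty)
    (hΞ : Summable fun k : NZ => ‖Ξ k.1‖) :
    HasSum (fun k : NZ => (1 / 2 : ℂ) • Ξ k.1 • (bStar kF k.1 * bStar kF (-k.1)))
      (bogCreate kF Ξ) :=
  (summable_bogCreate hB hΞ).hasSum.const_smul _

theorem star_bogGen (kF : ℝ) (Ξ : Mode → ℂ) : star (bogGen kF Ξ) = -bogGen kF Ξ := by
  rw [bogGen, ← ContinuousLinearMap.star_eq_adjoint, star_sub, star_star]
  abel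

theorem weightedPair_commute_bogCreate (g : Mode → ℝ) (k : Mode) :
    Commute (weightedPair kF g k) (bogCreate kF Ξ) := by
  refine Commute.smul_right (Commute.tsum_right _ fun l => ?_) _
  exact Commute.smul_right
    ((weightedPair_commute_bStar _ _ _ _).mul_right (weightedPair_commute_bStar _ _ _ _)) _

/-- The deviation of `[c, B]` from its bosonic value `Ξ(k) κ b*_{-k}`, where `c` is the annihilator
adjoint to `weightedPair kF g k` and `κ = pairMean kF g k`. -/
def genDefect (kF : ℝ) (Ξ : Mode → ℂ) (g : Mode → ℝ) (k : Mode) : Fock →L[ℂ] Fock :=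
  star (weightedPair kF g k) * bogGen kF Ξ - bogGen kF Ξ * star (weightedPair kF g k)
    - (Ξ k * pairMean kF g k) • bStar kF (-k)

theorem hasSum_genDefect (hB : (fermiBall kF).Nonempty) (hΞ : Summable fun k : NZ => ‖Ξ k.1‖)
    (hsymm : ∀ k, Ξ (-k) = Ξ k) (g : Mode → ℝ) {k : Mode} (hk : k ≠ 0) :
    HasSum (fun l : NZ => (1 / 2 : ℂ) • Ξ l.1 • (commDefect kF g k l.1 * bStar kF (-l.1)
      + bStar kF l.1 * commDefect kF g k (-l.1))) (genDefect kF Ξ g k) := by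
  set W := star (weightedPair kF g k) with hW
  have hstar : W * star (bogCreate kF Ξ) = star (bogCreate kF Ξ) * W := by
    have h := weightedPair_commute_bogCreate (kF := kF) (Ξ := Ξ) g k
    have h2 := congrArg star h.eq
    simpa [star_mul] using h2.symm
  have hcomm : W * bogGen kF Ξ - bogGen kF Ξ * W
      = W * bogCreate kF Ξ - bogCreate kF Ξ * W := by
    rw [bogGen, ← ContinuousLinearMap.star_eq_adjoint, mul_sub, sub_mul, hstar]
    abel
  have h1 := hasSum_bogCreate hB hΞ
  have h2 := (h1.mul_left W).sub (h1.mul_right W)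
  -- the bosonic part of the commutator: only `l = k` and `l = -k` contribute
  have h3 : HasSum (fun l : NZ => (1 / 2 : ℂ) • Ξ l.1 •
      (((if k = l.1 then (pairMean kF g k : ℂ) else 0) • bStar kF (-l.1))
        + ((if k = -l.1 then (pairMean kF g k : ℂ) else 0) • bStar kF l.1)))
      ((Ξ k * pairMean kF g k) • bStar kF (-k)) := by
    have e1 : HasSum (fun l : NZ => (1 / 2 : ℂ) • Ξ l.1 •
        ((if k = l.1 then (pairMean kF g k : ℂ) else 0) • bStar kF (-l.1)))
        ((1 / 2 : ℂ) • (Ξ k * pairMean kF g k) • bStar kF (-k)) := by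
      convert hasSum_single (⟨k, hk⟩ : NZ) ?_ using 1
      · simp [smul_smul, -Complex.coe_smul]
      · intro l hl
        rw [if_neg (fun h => hl (Subtype.ext h.symm))]
        simp
    have e2 : HasSum (fun l : NZ => (1 / 2 : ℂ) • Ξ l.1 •
        ((if k = -l.1 then (pairMean kF g k : ℂ) else 0) • bStar kF l.1))
        ((1 / 2 : ℂ) • (Ξ k * pairMean kF g k) • bStar kF (-k)) := by
      convert hasSum_single (⟨-k, neg_ne_zero.mpr hk⟩ : NZ) ?_ using 1
      · simp [smul_smul, hsymm, -Complex.coe_smul]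
      · intro l hl
        rw [if_neg (fun h => hl (Subtype.ext (neg_eq_iff_eq_neg.mp h.symm)))]
        simp
    convert e1.add e2 using 1
    · ext1 l; simp only [smul_add]
    · rw [← add_smul]; norm_num
  have h4 := h2.sub h3
  rw [genDefect, ← hW, hcomm]
  refine h4.congr_fun ?_
  intro l
  have hl : W * (bStar kF l.1 * bStar kF (-l.1)) - bStar kF l.1 * bStar kF (-l.1) * W
      = (W * bStar kF l.1 - bStar kF l.1 * W) * bStar kF (-l.1)
        + bStar kF l.1 * (W * bStar kF (-l.1) - bStar kF (-l.1) * W) := by noncomm_ring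
  simp only [mul_smul_comm, smul_mul_assoc, ← smul_sub, hl, commDefect, ← hW]
  congr 2
  rw [sub_mul, mul_sub, smul_mul_assoc, mul_smul_comm, one_mul, mul_one]
  abel

theorem summable_xiSum (hB : (fermiBall kF).Nonempty) (hΞ : Summable fun k : NZ => ‖Ξ k.1‖)
    {k : Mode} (hk : k ≠ 0) :
    Summable fun m : NZ => ‖Ξ m.1‖ / (pairNorm kF m.1 * pairNorm kF k) := by
  refine Summable.of_nonneg_of_le (fun m => ?_) (fun m => ?_) hΞ
  · exact div_nonneg (norm_nonneg _) (mul_nonneg (pairNorm_nonneg _ _) (pairNorm_nonneg _ _))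
  · have h1 := one_le_pairNorm hB m.2
    have h2 := one_le_pairNorm hB hk
    exact div_le_self (norm_nonneg _) (one_le_mul_of_one_le_of_one_le h1 h2)

theorem xiSum_nonneg (k : Mode) : 0 ≤ xiSum kF Ξ k :=
  tsum_nonneg fun _ =>
    div_nonneg (norm_nonneg _) (mul_nonneg (pairNorm_nonneg _ _) (pairNorm_nonneg _ _))

theorem xiSum_neg (k : Mode) : xiSum kF Ξ (-k) = xiSum kF Ξ k := by
  simp only [xiSum, pairNorm_neg]

/-- Summing the bounds on the individual defects of the generator. -/
theorem norm_le_of_hasSum_defects (hB : (fermiBall kF).Nonempty)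
    (hΞ : Summable fun k : NZ => ‖Ξ k.1‖) {k : Mode} (hk : k ≠ 0) {r : ℝ}
    {a : NZ → Fock} {b : Fock} (hb : HasSum a b)
    (ha : ∀ l : NZ, ‖a l‖ ≤ ‖Ξ l.1‖ / (pairNorm kF l.1 * pairNorm kF k) * r) :
    ‖b‖ ≤ xiSum kF Ξ k * r := by
  rw [← hb.tsum_eq]
  exact tsum_of_norm_bounded ((summable_xiSum hB hΞ hk).hasSum.mul_right r) ha

theorem norm_genDefect_le (hB : (fermiBall kF).Nonempty) (hΞ : Summable fun k : NZ => ‖Ξ k.1‖)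
    (hsymm : ∀ k, Ξ (-k) = Ξ k) {g : Mode → ℝ} {k : Mode} (hk : k ≠ 0) {D M : ℝ} (hD0 : 0 ≤ D)
    (hD : ∀ h ∈ lune kF k, |g h| ≤ D) (hM : 0 ≤ M) {ψ : Fock}
    (hψ : numberMoment (fun n => ((n + 2 : ℕ) : ENNReal) ^ 3) ψ ≤ ENNReal.ofReal (M ^ 2)) :
    ‖genDefect kF Ξ g k ψ‖ ≤ D * (xiSum kF Ξ k * (M / √2)) := by
  have h1 := (ContinuousLinearMap.apply ℂ Fock ψ).hasSum (hasSum_genDefect hB hΞ hsymm g hk)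
  rw [mul_left_comm]
  refine norm_le_of_hasSum_defects hB hΞ hk h1 fun l => ?_
  simp only [ContinuousLinearMap.apply_apply, smul_apply, add_apply,
    mul_apply_eq_comp, norm_smul]
  have e1 := norm_commDefect_bStar_le hD0 hD hM hψ l.1 (-l.1)
  have e2 := norm_bStar_commDefect_le hD0 hD hM hψ (-l.1) l.1
  rw [pairNorm_neg] at e2
  calc ‖(1 / 2 : ℂ)‖ * (‖Ξ l.1‖ * ‖commDefect kF g k l.1 (bStar kF (-l.1) ψ) +
        bStar kF l.1 (commDefect kF g k (-l.1) ψ)‖)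
      ≤ ‖(1 / 2 : ℂ)‖ * (‖Ξ l.1‖ * (D / (pairNorm kF k * pairNorm kF l.1) * (M / √2) +
        D / (pairNorm kF k * pairNorm kF l.1) * (M / √2))) := by
        gcongr
        exact (norm_add_le _ _).trans (add_le_add e1 e2)
    _ = _ := by norm_num; ring

theorem norm_star_genDefect_le (hB : (fermiBall kF).Nonempty)
    (hΞ : Summable fun k : NZ => ‖Ξ k.1‖)
    (hsymm : ∀ k, Ξ (-k) = Ξ k) {k : Mode} (hk : k ≠ 0) {M : ℝ} (hM : 0 ≤ M) {ψ : Fock}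
    (hψ : numberMoment (fun n => ((n + 2 : ℕ) : ENNReal) ^ 3) ψ ≤ ENNReal.ofReal (M ^ 2)) :
    ‖star (genDefect kF Ξ (fun _ => 1) k) ψ‖ ≤ xiSum kF Ξ k * (M / √2) := by
  have h1 := (ContinuousLinearMap.apply ℂ Fock ψ).hasSum
    (hasSum_genDefect hB hΞ hsymm (fun _ => 1) hk).star
  refine norm_le_of_hasSum_defects hB hΞ hk h1 fun l => ?_
  simp only [ContinuousLinearMap.apply_apply, smul_apply, add_apply,
    mul_apply_eq_comp, star_smul, star_add, star_mul, star_commDefect_one, norm_smul, norm_star]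
  have hD : ∀ m, ∀ h ∈ lune kF m, |(1 : ℝ)| ≤ 1 := by simp
  have e1 := norm_star_bStar_commDefect_le (g := fun _ => 1) zero_le_one (hD l.1) hM hψ k (-l.1)
  have e2 := norm_commDefect_star_bStar_le (g := fun _ => 1) zero_le_one (hD (-l.1)) hM hψ k l.1
  rw [pairNorm_neg] at e2
  calc ‖(1 / 2 : ℂ)‖ * (‖Ξ l.1‖ * ‖star (bStar kF (-l.1)) (commDefect kF (fun _ => 1) l.1 k ψ) +
        commDefect kF (fun _ => 1) (-l.1) k (star (bStar kF l.1) ψ)‖)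
      ≤ ‖(1 / 2 : ℂ)‖ * (‖Ξ l.1‖ * (1 / (pairNorm kF l.1 * pairNorm kF k) * (M / √2) +
        1 / (pairNorm kF l.1 * pairNorm kF k) * (M / √2))) := by
        gcongr
        exact (norm_add_le _ _).trans (add_le_add e1 e2)
    _ = _ := by norm_num; ring

end Generator

/-! ### Perturbed Bogoliubov dynamics in a Hilbert space -/

section Dynamics

open MeasureTheory intervalIntegral

variable {H : Type*} [NormedAddCommGroup H] [InnerProductSpace ℂ H]
  {ξ : ℂ} {κ η ηc : ℝ} {u v c ε₁ ε₂ ε₃ : ℝ → H} {v₀ : H}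

/-- The solution of `u' = ξ v + ε₁`, `v' = ξ̄ u + ε₂` with `u(0) = 0` follows the hyperbolic rotation
of `v(0)` up to a Grönwall error. -/
theorem norm_sub_cosh_smul_le (hξ : ξ ≠ 0) (hη : 0 ≤ η)
    (hu : ∀ t, HasDerivAt u (ξ • v t + ε₁ t) t)
    (hv : ∀ t, HasDerivAt v ((starRingEnd ℂ) ξ • u t + ε₂ t) t)
    (hu0 : u 0 = 0) (hv0 : v 0 = v₀)
    (h1 : ∀ t ∈ Set.Icc (0 : ℝ) 1, ‖ε₁ t‖ ≤ η) (h2 : ∀ t ∈ Set.Icc (0 : ℝ) 1, ‖ε₂ t‖ ≤ η)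
    {t : ℝ} (ht : t ∈ Set.Icc (0 : ℝ) 1) :
    ‖v t - (Real.cosh (‖ξ‖ * t) : ℂ) • v₀‖ ≤ η * (Real.exp ‖ξ‖ - 1) / ‖ξ‖ := by
  set x := ‖ξ‖ with hx
  have hx0 : 0 < x := norm_pos_iff.mpr hξ
  have hxC : (x : ℂ) ≠ 0 := by exact_mod_cast hx0.ne'
  set q : ℝ → H := fun t => u t - (ξ / x * (Real.sinh (x * t) : ℂ)) • v₀ with hq
  set r : ℝ → H := fun t => v t - (Real.cosh (x * t) : ℂ) • v₀ with hr
  have hlin : ∀ t : ℝ, HasDerivAt (fun t => x * t) x t := fun t => by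
    simpa using (hasDerivAt_id t).const_mul x
  have hq' : ∀ t, HasDerivAt q (ξ • r t + ε₁ t) t := by
    intro t
    have e := ((((hlin t).sinh).ofReal_comp.const_mul (ξ / (x : ℂ))).smul_const v₀)
    refine HasDerivAt.congr_deriv ((hu t).sub e) ?_
    simp only [hr, smul_sub, smul_smul]
    have : ξ / (x : ℂ) * ((Real.cosh (x * t) * x : ℝ) : ℂ) = ξ * (Real.cosh (x * t) : ℂ) := by
      push_cast; field_simp
    rw [this]
    abel
  have hr' : ∀ t, HasDerivAt r ((starRingEnd ℂ) ξ • q t + ε₂ t) t := by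
    intro t
    have e := (((hlin t).cosh).ofReal_comp.smul_const v₀)
    refine HasDerivAt.congr_deriv ((hv t).sub e) ?_
    simp only [hq, smul_sub, smul_smul]
    have hxx : (starRingEnd ℂ) ξ * ξ = (x : ℂ) * x := by
      rw [Complex.conj_mul', sq]
    have : (starRingEnd ℂ) ξ * (ξ / (x : ℂ) * (Real.sinh (x * t) : ℂ)) =
        ((Real.sinh (x * t) * x : ℝ) : ℂ) := by
      calc _ = (starRingEnd ℂ) ξ * ξ / x * (Real.sinh (x * t) : ℂ) := by ring
        _ = _ := by rw [hxx]; push_cast; field_simp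
    rw [this]
    abel
  -- Grönwall in `H × H` with the sup norm: the coupling of `q` and `r` has norm `x`, so no factor is
  -- lost against the exponent
  have key := norm_le_gronwallBound_of_norm_deriv_right_le (f := fun t => (q t, r t))
    (f' := fun t => (ξ • r t + ε₁ t, (starRingEnd ℂ) ξ • q t + ε₂ t)) (δ := 0) (K := x) (ε := η)
    (a := 0) (b := 1) (fun t _ => ((hq' t).prodMk (hr' t)).continuousAt.continuousWithinAt)
    (fun t _ => ((hq' t).prodMk (hr' t)).hasDerivWithinAt)
    (by simp [hq, hr, hu0, hv0]) ?_ t ht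
  · rw [sub_zero, gronwallBound_of_K_ne_0 hx0.ne'] at key
    refine (norm_snd_le (q t, r t)).trans (key.trans ?_)
    simp only [zero_mul, zero_add, div_mul_eq_mul_div]
    gcongr
    exact mul_le_of_le_one_right hx0.le ht.2
  · intro t ht
    have ht' := Set.Ico_subset_Icc_self ht
    refine max_le ?_ ?_
    · refine (norm_add_le _ _).trans (add_le_add ?_ (h1 t ht'))
      rw [norm_smul]
      gcongr
      exact norm_snd_le (q t, r t)
    · refine (norm_add_le _ _).trans (add_le_add ?_ (h2 t ht'))
      rw [norm_smul, RCLike.norm_conj]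
      gcongr
      exact norm_fst_le (q t, r t)

/-- For `u' = ξ v + ε₁`, `v' = ξ̄ u + ε₂`, `c' = ξ κ v + ε₃` with `u(0) = c(0) = 0`, the quantity
`2 Re ∫ ξ ⟪c, v⟫` equals `κ sinh² |ξ|` up to the stated error. Up to the contribution of `ε₃`, the
integrand is the derivative of `κ |ξ|² ‖∫₀ᵗ v‖²`. -/
theorem abs_integral_sub_sinh_sq_le [CompleteSpace H] (hη : 0 ≤ η) (hηc : 0 ≤ ηc)
    (hu : ∀ t, HasDerivAt u (ξ • v t + ε₁ t) t)
    (hv : ∀ t, HasDerivAt v ((starRingEnd ℂ) ξ • u t + ε₂ t) t)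
    (hc : ∀ t, HasDerivAt c ((ξ * κ) • v t + ε₃ t) t)
    (hu0 : u 0 = 0) (hv0 : v 0 = v₀) (hc0 : c 0 = 0) (hv₀ : ‖v₀‖ = 1)
    (h1 : ∀ t ∈ Set.Icc (0 : ℝ) 1, ‖ε₁ t‖ ≤ η) (h2 : ∀ t ∈ Set.Icc (0 : ℝ) 1, ‖ε₂ t‖ ≤ η)
    (h3 : ∀ t ∈ Set.Icc (0 : ℝ) 1, ‖ε₃ t‖ ≤ ηc) :
    |(∫ t in (0 : ℝ)..1, 2 * (ξ * ⟪c t, v t⟫_ℂ).re) - κ * Real.sinh ‖ξ‖ ^ 2| ≤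
      |κ| * (2 * Real.sinh ‖ξ‖ * (η * (Real.exp ‖ξ‖ - 1)) + (η * (Real.exp ‖ξ‖ - 1)) ^ 2)
        + 2 * ηc * Real.sinh ‖ξ‖ + ηc * (η * (Real.exp ‖ξ‖ - 1)) := by
  rcases eq_or_ne ξ 0 with rfl | hξ
  · simp
  have hr := fun {t : ℝ} (ht : t ∈ Set.Icc (0 : ℝ) 1) =>
    norm_sub_cosh_smul_le hξ hη hu hv hu0 hv0 h1 h2 ht
  set x := ‖ξ‖ with hx
  have hx0 : 0 < x := norm_pos_iff.mpr hξ
  set ρ := η * (Real.exp x - 1) / x with hρ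
  have hxρ : x * ρ = η * (Real.exp x - 1) := by rw [hρ]; field_simp
  have hρ0 : 0 ≤ ρ := by
    have : 1 ≤ Real.exp x := Real.one_le_exp hx0.le
    exact div_nonneg (mul_nonneg hη (by linarith)) hx0.le
  have hlin : ∀ t : ℝ, HasDerivAt (fun t => x * t) x t := fun t => by
    simpa using (hasDerivAt_id t).const_mul x
  have hvc : Continuous v := continuous_iff_continuousAt.mpr fun t => (hv t).continuousAt
  have hcc : Continuous c := continuous_iff_continuousAt.mpr fun t => (hc t).continuousAt
  set V : ℝ → H := fun t => ∫ s in (0 : ℝ)..t, v s with hV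
  have hV' : ∀ t, HasDerivAt V (v t) t := fun t => (hvc.integral_hasStrictDerivAt 0 t).hasDerivAt
  have hV0 : V 0 = 0 := by simp [hV]
  have hVc : Continuous V := continuous_iff_continuousAt.mpr fun t => (hV' t).continuousAt
  -- `z` collects the contribution of `ε₃` to `c`
  set z : ℝ → H := fun t => c t - (ξ * κ) • V t with hz
  have hz' : ∀ t, HasDerivAt z (ε₃ t) t := by
    intro t
    refine HasDerivAt.congr_deriv ((hc t).sub ((hV' t).const_smul (ξ * (κ : ℂ)))) ?_
    abel
  have hzc : Continuous z := continuous_iff_continuousAt.mpr fun t => (hz' t).continuousAt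
  have hzn : ∀ t ∈ Set.Icc (0 : ℝ) 1, ‖z t‖ ≤ ηc * t := by
    intro t ht
    have := norm_image_sub_le_of_norm_deriv_le_segment' (f := z) (f' := ε₃) (C := ηc)
      (fun t _ => (hz' t).hasDerivWithinAt) (fun t ht => h3 t (Set.Ico_subset_Icc_self ht)) t ht
    simpa [hz, hc0, hV0] using this
  -- the endpoint of `V`
  have hVend : ‖V 1 - ((Real.sinh x / x : ℝ) : ℂ) • v₀‖ ≤ ρ := by
    have hd : ∀ t, HasDerivAt (fun t => V t - ((Real.sinh (x * t) / x : ℝ) : ℂ) • v₀)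
        (v t - (Real.cosh (x * t) : ℂ) • v₀) t := by
      intro t
      have e := ((((hlin t).sinh).div_const x).ofReal_comp.smul_const v₀)
      rw [mul_div_assoc, div_self hx0.ne', mul_one] at e
      exact (hV' t).sub e
    have := norm_image_sub_le_of_norm_deriv_le_segment' (C := ρ)
      (fun t _ => (hd t).hasDerivWithinAt) (fun t ht => hr (Set.Ico_subset_Icc_self ht)) 1
      (Set.right_mem_Icc.mpr zero_le_one)
    simpa [hV0] using this
  have hsplit : ∀ t, 2 * (ξ * ⟪c t, v t⟫_ℂ).re =
      κ * x ^ 2 * (⟪V t, v t⟫_ℂ + ⟪v t, V t⟫_ℂ).re + 2 * (ξ * ⟪z t, v t⟫_ℂ).re := by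
    intro t
    have e1 : c t = z t + (ξ * κ) • V t := by simp [hz]
    have e2 : (⟪V t, v t⟫_ℂ + ⟪v t, V t⟫_ℂ).re = 2 * (⟪V t, v t⟫_ℂ).re := by
      rw [Complex.add_re, ← inner_conj_symm (v t) (V t), Complex.conj_re]; ring
    have e3 : ξ * ((starRingEnd ℂ) (ξ * κ) * ⟪V t, v t⟫_ℂ) =
        ((κ * x ^ 2 : ℝ) : ℂ) * ⟪V t, v t⟫_ℂ := by
      rw [map_mul, Complex.conj_ofReal]
      calc _ = (ξ * (starRingEnd ℂ) ξ) * κ * ⟪V t, v t⟫_ℂ := by ring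
        _ = _ := by rw [Complex.mul_conj']; push_cast; ring
    rw [e1, inner_add_left, inner_smul_left, mul_add, e3, Complex.add_re, Complex.re_ofReal_mul, e2]
    ring
  have hmain : ∫ t in (0 : ℝ)..1, κ * x ^ 2 * (⟪V t, v t⟫_ℂ + ⟪v t, V t⟫_ℂ).re =
      κ * x ^ 2 * ‖V 1‖ ^ 2 := by
    have hd : ∀ t, HasDerivAt (fun t => κ * x ^ 2 * (⟪V t, V t⟫_ℂ).re)
        (κ * x ^ 2 * (⟪V t, v t⟫_ℂ + ⟪v t, V t⟫_ℂ).re) t := fun t =>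
      (Complex.reCLM.hasFDerivAt.comp_hasDerivAt t ((hV' t).inner ℂ (hV' t))).const_mul _
    rw [integral_eq_sub_of_hasDerivAt (fun t _ => hd t)
      (Continuous.intervalIntegrable (by fun_prop) _ _)]
    simp [hV0, inner_self_eq_norm_sq_to_K]
    left
    norm_cast
  have hrest : |∫ t in (0 : ℝ)..1, 2 * (ξ * ⟪z t, v t⟫_ℂ).re| ≤
      2 * ηc * Real.sinh x + ηc * (x * ρ) := by
    have hd : ∀ t, HasDerivAt (fun t => 2 * ηc * Real.sinh (x * t) + ηc * (x * ρ) * t ^ 2)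
        (2 * ηc * (Real.cosh (x * t) * x) + ηc * (x * ρ) * (2 * t)) t := by
      intro t
      have e := (((hlin t).sinh).const_mul (2 * ηc)).add
        (((hasDerivAt_pow 2 t)).const_mul (ηc * (x * ρ)))
      exact e.congr_deriv (by simp)
    have hcont : Continuous fun t => 2 * ηc * (Real.cosh (x * t) * x) + ηc * (x * ρ) * (2 * t) := by
      fun_prop
    have e := norm_integral_le_of_norm_le (μ := volume) (a := 0) (b := 1) zero_le_one
      (f := fun t => 2 * (ξ * ⟪z t, v t⟫_ℂ).re)
      (g := fun t => 2 * ηc * (Real.cosh (x * t) * x) + ηc * (x * ρ) * (2 * t))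
      (ae_of_all _ fun t ht => ?_) (hcont.intervalIntegrable _ _)
    · rw [integral_eq_sub_of_hasDerivAt (fun t _ => hd t) (hcont.intervalIntegrable _ _)] at e
      simpa using e
    · have ht' : t ∈ Set.Icc (0 : ℝ) 1 := Set.Ioc_subset_Icc_self ht
      have hvn : ‖v t‖ ≤ Real.cosh (x * t) + ρ := by
        have e1 : v t = (Real.cosh (x * t) : ℂ) • v₀ + (v t - (Real.cosh (x * t) : ℂ) • v₀) := by
          abel
        rw [e1]
        refine (norm_add_le _ _).trans (add_le_add (le_of_eq ?_) (hr ht'))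
        rw [norm_smul, hv₀, mul_one, Complex.norm_real, Real.norm_eq_abs,
          abs_of_pos (Real.cosh_pos _)]
      have hb : |(ξ * ⟪z t, v t⟫_ℂ).re| ≤ x * (ηc * t * (Real.cosh (x * t) + ρ)) := by
        refine (Complex.abs_re_le_norm _).trans ?_
        rw [norm_mul]
        gcongr
        refine (norm_inner_le_norm _ _).trans ?_
        have := hzn t ht'
        gcongr
        exact mul_nonneg hηc ht'.1
      rw [Real.norm_eq_abs, abs_mul, abs_two]
      have hp : 0 ≤ x * ηc * Real.cosh (x * t) := by
        have := Real.cosh_pos (x * t)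
        positivity
      nlinarith [mul_nonneg hp (sub_nonneg.mpr ht'.2)]
  have hI : (∫ t in (0 : ℝ)..1, 2 * (ξ * ⟪c t, v t⟫_ℂ).re) = κ * x ^ 2 * ‖V 1‖ ^ 2
      + ∫ t in (0 : ℝ)..1, 2 * (ξ * ⟪z t, v t⟫_ℂ).re := by
    simp only [hsplit]
    rw [integral_add (Continuous.intervalIntegrable (by fun_prop) _ _)
      (Continuous.intervalIntegrable (by fun_prop) _ _), hmain]
  have hsq : |κ * x ^ 2 * ‖V 1‖ ^ 2 - κ * Real.sinh x ^ 2| ≤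
      |κ| * (2 * Real.sinh x * (x * ρ) + (x * ρ) ^ 2) := by
    set s := Real.sinh x / x with hs
    have hsh : Real.sinh x = x * s := by rw [hs]; field_simp
    have hs0 : 0 ≤ s := div_nonneg (Real.sinh_nonneg_iff.mpr hx0.le) hx0.le
    have hns : ‖((s : ℝ) : ℂ) • v₀‖ = s := by
      rw [norm_smul, hv₀, mul_one, Complex.norm_real, Real.norm_eq_abs, abs_of_nonneg hs0]
    have hdiff : |‖V 1‖ - s| ≤ ρ := by
      have := abs_norm_sub_norm_le (V 1) (((s : ℝ) : ℂ) • v₀)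
      rw [hns] at this
      exact this.trans hVend
    obtain ⟨d1, d2⟩ := abs_le.mp hdiff
    have hsq2 : |‖V 1‖ ^ 2 - s ^ 2| ≤ 2 * s * ρ + ρ ^ 2 := by
      have e : ‖V 1‖ ^ 2 - s ^ 2 = (‖V 1‖ - s) * (‖V 1‖ + s) := by ring
      rw [e, abs_mul, abs_of_nonneg (add_nonneg (norm_nonneg (V 1)) hs0)]
      calc _ ≤ ρ * ((s + ρ) + s) := by gcongr; linarith
        _ = _ := by ring
    have e : κ * x ^ 2 * ‖V 1‖ ^ 2 - κ * Real.sinh x ^ 2 = κ * (x ^ 2 * (‖V 1‖ ^ 2 - s ^ 2)) := by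
      rw [hsh]; ring
    rw [e, abs_mul, abs_mul, abs_of_nonneg (sq_nonneg x)]
    gcongr
    calc x ^ 2 * |‖V 1‖ ^ 2 - s ^ 2| ≤ x ^ 2 * (2 * s * ρ + ρ ^ 2) := by gcongr
      _ = _ := by rw [hsh]; ring
  rw [hI, ← hxρ]
  calc |κ * x ^ 2 * ‖V 1‖ ^ 2 + (∫ t in (0 : ℝ)..1, 2 * (ξ * ⟪z t, v t⟫_ℂ).re)
        - κ * Real.sinh x ^ 2|
      = |(κ * x ^ 2 * ‖V 1‖ ^ 2 - κ * Real.sinh x ^ 2)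
          + ∫ t in (0 : ℝ)..1, 2 * (ξ * ⟪z t, v t⟫_ℂ).re| := by congr 1; ring
    _ ≤ _ := (abs_add_le _ _).trans (add_le_add hsq hrest)
    _ = _ := by ring

end Dynamics

/-! ### Conjugation by the unitary group of a bounded skew-adjoint generator -/

section UnitaryGroup

variable {H : Type*} [NormedAddCommGroup H] [InnerProductSpace ℂ H] [CompleteSpace H]

/-- The group `t ↦ exp(tB)` generated by a bounded operator `B`. -/
def expGroup (B : H →L[ℂ] H) (t : ℝ) : H →L[ℂ] H := NormedSpace.exp ((t : ℂ) • B)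

variable {B : H →L[ℂ] H}

theorem expGroup_zero : expGroup B 0 = 1 := by simp [expGroup]

theorem expGroup_neg_mul (t : ℝ) : expGroup B (-t) * expGroup B t = 1 := by
  have h : Commute ((((-t : ℝ) : ℂ)) • B) ((t : ℂ) • B) :=
    (Commute.refl B).smul_left _ |>.smul_right _
  rw [expGroup, expGroup, ← NormedSpace.exp_add_of_commute_of_mem_ball (𝕂 := ℂ) h]
  · simp
  · simp [NormedSpace.expSeries_radius_eq_top]
  · simp [NormedSpace.expSeries_radius_eq_top]

theorem star_expGroup (hB : star B = -B) (t : ℝ) : star (expGroup B t) = expGroup B (-t) := by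
  rw [expGroup, NormedSpace.star_exp, expGroup, star_smul, hB]
  simp

theorem inner_expGroup (hB : star B = -B) (t : ℝ) (φ χ : H) :
    ⟪expGroup B t φ, expGroup B t χ⟫_ℂ = ⟪φ, χ⟫_ℂ := by
  have h : ⟪φ, (star (expGroup B t) * expGroup B t) χ⟫_ℂ = ⟪φ, χ⟫_ℂ := by
    rw [star_expGroup hB, expGroup_neg_mul]; simp
  rwa [mul_apply_eq_comp, ContinuousLinearMap.star_eq_adjoint,
    ContinuousLinearMap.adjoint_inner_right] at h

theorem norm_expGroup_apply (hB : star B = -B) (t : ℝ) (φ : H) : ‖expGroup B t φ‖ = ‖φ‖ := by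
  have h := inner_expGroup hB t φ φ
  rw [inner_self_eq_norm_sq_to_K, inner_self_eq_norm_sq_to_K] at h
  have h2 : ‖expGroup B t φ‖ ^ 2 = ‖φ‖ ^ 2 := by exact_mod_cast h
  exact (sq_eq_sq₀ (norm_nonneg _) (norm_nonneg _)).mp h2

theorem hasDerivAt_expGroup (t : ℝ) :
    HasDerivAt (fun t : ℝ => expGroup B t) (B * expGroup B t) t := by
  have h := (hasDerivAt_exp_smul_const' B (t : ℂ)).scomp t (hasDerivAt_id t).ofReal_comp
  exact h.congr_deriv (by simp [expGroup])

theorem hasDerivAt_expGroup_neg (t : ℝ) :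
    HasDerivAt (fun t : ℝ => expGroup B (-t)) (-(expGroup B (-t) * B)) t := by
  have h := (hasDerivAt_exp_smul_const B ((-t : ℝ) : ℂ)).scomp t (hasDerivAt_neg t).ofReal_comp
  exact h.congr_deriv (by simp [expGroup])

/-- Heisenberg equation for `exp(-tB) A exp(tB)`. -/
theorem hasDerivAt_conj_apply (A : H →L[ℂ] H) (φ : H) (t : ℝ) :
    HasDerivAt (fun t : ℝ => expGroup B (-t) (A (expGroup B t φ)))
      (expGroup B (-t) ((A * B - B * A) (expGroup B t φ))) t := by
  have h := (((hasDerivAt_expGroup_neg (B := B) t).mul_const A).mul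
    (hasDerivAt_expGroup (B := B) t))
  have h2 := (((ContinuousLinearMap.apply ℂ H φ).restrictScalars ℝ).hasFDerivAt.comp_hasDerivAt t h)
  refine HasDerivAt.congr_deriv h2 ?_
  have e : -(expGroup B (-t) * B) * A * expGroup B t + expGroup B (-t) * A * (B * expGroup B t)
      = expGroup B (-t) * ((A * B - B * A) * expGroup B t) := by noncomm_ring
  rw [e]
  rfl

end UnitaryGroup

theorem bogT_eq_expGroup (kF : ℝ) (Ξ : Mode → ℂ) (t : ℝ) :
    bogT kF Ξ t = expGroup (bogGen kF Ξ) t := rfl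

theorem norm_vacuum : ‖vacuum‖ = 1 := by
  rw [vacuum, lp.norm_single (by norm_num)]; simp

theorem star_weightedPair_vacuum (kF : ℝ) (g : Mode → ℝ) (k : Mode) :
    star (weightedPair kF g k) vacuum = 0 := by
  rw [star_weightedPair, smul_apply, sum_apply, Finset.sum_eq_zero, smul_zero]
  intro h _
  rw [smul_apply, mul_apply_eq_comp, annihilate_vacuum, map_zero, smul_zero]

theorem pairMean_one {kF : ℝ} (hB : (fermiBall kF).Nonempty) {k : Mode} (hk : k ≠ 0) :
    pairMean kF (fun _ => 1) k = 1 := by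
  have h := one_le_pairNorm hB hk
  have h2 : (0 : ℝ) < (lune kF k).card := by rw [← pairNorm_sq]; positivity
  rw [pairMean, pairNorm_sq]
  simp only [Finset.sum_const, nsmul_eq_mul, mul_one]
  exact inv_mul_cancel₀ h2.ne'

theorem norm_bStar_vacuum {kF : ℝ} (hB : (fermiBall kF).Nonempty) {k : Mode} (hk : k ≠ 0) :
    ‖bStar kF k vacuum‖ = 1 := by
  have h := one_le_pairNorm hB hk
  rw [bStar, smul_apply, norm_smul, norm_inv, Complex.norm_real, Real.norm_eq_abs,
    abs_of_nonneg (pairNorm_nonneg _ _)]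
  exact inv_mul_cancel₀ (by linarith : pairNorm kF k ≠ 0)

/-- The contribution of the momentum `k` to the kinetic energy of the trial state, for pairs weighted
by `g`. -/
def pairEnergy (kF : ℝ) (Ξ : Mode → ℂ) (g : Mode → ℝ) (k : Mode) : ℝ :=
  ∫ t in (0 : ℝ)..1, 2 * (Ξ k * ⟪star (weightedPair kF g k) (bogT kF Ξ t vacuum),
    bStar kF (-k) (bogT kF Ξ t vacuum)⟫_ℂ).re

/-- The energy of a pair mode is the one of an exact Bogoliubov transformation up to an error
controlled by the third moment of the number operator along the flow. -/
theorem abs_pairEnergy_sub_le {kF : ℝ} {Ξ : Mode → ℂ} (hB : (fermiBall kF).Nonempty)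
    (hΞ : Summable fun k : NZ => ‖Ξ k.1‖) (hsymm : ∀ k, Ξ (-k) = Ξ k) {g : Mode → ℝ} {k : Mode}
    (hk : k ≠ 0) {D M : ℝ} (hD0 : 0 ≤ D) (hD : ∀ h ∈ lune kF k, |g h| ≤ D) (hM : 0 ≤ M)
    (hψ : ∀ t ∈ Set.Icc (0 : ℝ) 1,
      numberMoment (fun n => ((n + 2 : ℕ) : ENNReal) ^ 3) (bogT kF Ξ t vacuum) ≤
        ENNReal.ofReal (M ^ 2)) {η : ℝ} (hη : η = xiSum kF Ξ k * (M / √2)) :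
    |pairEnergy kF Ξ g k - pairMean kF g k * Real.sinh ‖Ξ k‖ ^ 2| ≤
      |pairMean kF g k| * (2 * Real.sinh ‖Ξ k‖ * (η * (Real.exp ‖Ξ k‖ - 1))
          + (η * (Real.exp ‖Ξ k‖ - 1)) ^ 2)
        + 2 * (D * η) * Real.sinh ‖Ξ k‖ + D * η * (η * (Real.exp ‖Ξ k‖ - 1)) := by
  have hsk := star_bogGen kF Ξ
  have hη0 : 0 ≤ η := by rw [hη]; exact mul_nonneg (xiSum_nonneg k) (by positivity)
  set B := bogGen kF Ξ with hBdef
  have hone : ∀ k, star (weightedPair kF (fun _ => 1) k) = star (bStar kF k) := fun k => by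
    rw [bStar_eq_weightedPair]
  have hk' : -k ≠ 0 := neg_ne_zero.mpr hk
  have cu : star (bStar kF k) * B - B * star (bStar kF k) =
      Ξ k • bStar kF (-k) + genDefect kF Ξ (fun _ => 1) k := by
    rw [genDefect, hone, pairMean_one hB hk, ← hBdef]
    simp
  have cv : bStar kF (-k) * B - B * bStar kF (-k) =
      (starRingEnd ℂ) (Ξ k) • star (bStar kF k) + star (genDefect kF Ξ (fun _ => 1) (-k)) := by
    rw [genDefect, hone, pairMean_one hB hk', ← hBdef]
    simp only [star_sub, star_mul, star_smul, star_star, hsk, hsymm, neg_neg]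
    simp
    abel
  have cc : star (weightedPair kF g k) * B - B * star (weightedPair kF g k) =
      (Ξ k * pairMean kF g k) • bStar kF (-k) + genDefect kF Ξ g k := by
    rw [genDefect, ← hBdef]
    abel
  -- the Heisenberg equations are a perturbed Bogoliubov system with `η` bounding the perturbation
  have du := hasDerivAt_conj_apply (B := B) (star (bStar kF k)) vacuum
  have dv := hasDerivAt_conj_apply (B := B) (bStar kF (-k)) vacuum
  have dc := hasDerivAt_conj_apply (B := B) (star (weightedPair kF g k)) vacuum
  simp only [cu, add_apply, smul_apply, map_add, map_smul] at du
  simp only [cv, add_apply, smul_apply, map_add, map_smul] at dv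
  simp only [cc, add_apply, smul_apply, map_add, map_smul] at dc
  have key := abs_integral_sub_sinh_sq_le hη0 (mul_nonneg hD0 hη0) du dv dc
    (by simp [expGroup_zero, ← hone, star_weightedPair_vacuum]) rfl
    (by simp [expGroup_zero, star_weightedPair_vacuum])
    (by simpa [expGroup_zero] using norm_bStar_vacuum hB hk') ?_ ?_ ?_
  · convert key using 4
    rw [pairEnergy]
    refine intervalIntegral.integral_congr fun t _ => ?_
    rw [inner_expGroup hsk]
    rfl
  · intro t ht
    rw [norm_expGroup_apply hsk, hη]
    refine (norm_genDefect_le hB hΞ hsymm hk zero_le_one (by simp) hM (hψ t ht)).trans ?_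
    rw [one_mul]
  · intro t ht
    rw [norm_expGroup_apply hsk, hη, ← xiSum_neg]
    exact norm_star_genDefect_le hB hΞ hsymm hk' hM (hψ t ht)
  · intro t ht
    rw [norm_expGroup_apply hsk, hη]
    exact norm_genDefect_le hB hΞ hsymm hk hD0 hD hM (hψ t ht)

/-! ### Truncated kinetic energy along the flow -/

/-- The bounded truncation `∑_{q ∈ F} e(q) a*_q a_q` of `dGamma e` to finitely many modes. -/
def truncKinetic (e : Mode → ℝ) (F : Finset Mode) : Fock →L[ℂ] Fock :=
  ∑ q ∈ F, (e q : ℂ) • (create q * annihilate q)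

/-- The energy `e(h + k) + e(h)` of the pair `(h + k, h)`, where modes outside `F` do not count. -/
def pairWeight (e : Mode → ℝ) (F : Finset Mode) (k h : Mode) : ℝ :=
  (if h + k ∈ F then e (h + k) else 0) + (if h ∈ F then e h else 0)

section Truncated

variable {kF : ℝ} {Ξ : Mode → ℂ} {e : Mode → ℝ} {F : Finset Mode}

theorem truncKinetic_apply (ψ : Fock) (S : Finset Mode) :
    truncKinetic e F ψ S = ((∑ q ∈ S, if q ∈ F then e q else 0 : ℝ) : ℂ) * ψ S := by
  have h : ∀ q ∈ F, ((e q : ℂ) • (create q * annihilate q)) ψ S =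
      (if q ∈ S then (e q : ℂ) else 0) * ψ S := by
    intro q _
    rw [smul_apply, lp.coeFn_smul, Pi.smul_apply, create_mul_annihilate_apply]
    by_cases hq : q ∈ S
    · simp [hq, Finset.insert_erase hq, jwSign_mul_self]
    · simp [hq]
  rw [truncKinetic, sum_apply, lp.coeFn_sum, Finset.sum_apply, Finset.sum_congr rfl h,
    ← Finset.sum_mul, ← Finset.sum_filter, ← Finset.sum_filter]
  push_cast
  congr 2
  ext q
  simp [and_comm]

theorem star_truncKinetic : star (truncKinetic e F) = truncKinetic e F := by
  simp only [truncKinetic, star_sum, star_smul, star_mul, star_create, star_annihilate]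
  simp

theorem truncKinetic_vacuum : truncKinetic e F vacuum = 0 := by
  rw [truncKinetic, sum_apply, Finset.sum_eq_zero]
  intro q _
  rw [smul_apply, mul_apply_eq_comp, annihilate_vacuum, map_zero, smul_zero]

theorem truncKinetic_mul_create (p : Mode) :
    truncKinetic e F * create p =
      create p * truncKinetic e F + ((if p ∈ F then e p else 0 : ℝ) : ℂ) • create p := by
  have h : ∀ q, create q * annihilate q * create p =
      create p * (create q * annihilate q) + if q = p then create p else 0 := by
    intro q
    have h1 := annihilate_mul_create q p
    have h2 := create_mul_create q p
    calc create q * annihilate q * create p = create q * (annihilate q * create p) := by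
          noncomm_ring
      _ = create q * (if q = p then 1 else 0) - (create q * create p) * annihilate q := by
          rw [h1]; noncomm_ring
      _ = create q * (if q = p then 1 else 0) + create p * (create q * annihilate q) := by
          rw [h2]; noncomm_ring
      _ = _ := by
          by_cases hq : q = p
          · subst hq; simp; abel
          · simp [hq]
  have h2 : ∀ q ∈ F, (e q : ℂ) • (create q * annihilate q) * create p =
      create p * ((e q : ℂ) • (create q * annihilate q))
        + if q = p then (e p : ℂ) • create p else 0 := by
    intro q _
    rw [smul_mul_assoc, h, smul_add, mul_smul_comm]
    by_cases hq : q = p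
    · simp [hq]
    · simp [hq]
  rw [truncKinetic, Finset.sum_mul, Finset.mul_sum, Finset.sum_congr rfl h2,
    Finset.sum_add_distrib, Finset.sum_ite_eq']
  congr 1
  split_ifs <;> simp

theorem truncKinetic_commutator_bStar (k : Mode) :
    truncKinetic e F * bStar kF k =
      bStar kF k * truncKinetic e F + weightedPair kF (pairWeight e F k) k := by
  have h : ∀ h : Mode, truncKinetic e F * (create (h + k) * create h) =
      create (h + k) * create h * truncKinetic e F
        + (pairWeight e F k h : ℂ) • (create (h + k) * create h) := by
    intro h
    rw [← mul_assoc, truncKinetic_mul_create, add_mul, mul_assoc, truncKinetic_mul_create,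
      mul_add, pairWeight, mul_smul_comm, smul_mul_assoc, Complex.ofReal_add, add_smul, mul_assoc]
    abel
  rw [bStar, pairCreate, weightedPair]
  simp only [mul_smul_comm, smul_mul_assoc, Finset.mul_sum, Finset.sum_mul, h,
    Finset.sum_add_distrib, smul_add]

/-- Momentum reflection on the nonzero lattice momenta. -/
def negNZ : NZ ≃ NZ where
  toFun k := ⟨-k.1, neg_ne_zero.mpr k.2⟩
  invFun k := ⟨-k.1, neg_ne_zero.mpr k.2⟩
  left_inv k := by simp
  right_inv k := by simp

theorem norm_pairTerm_le (hB : (fermiBall kF).Nonempty) {g : Mode → ℝ} {k : Mode} {D : ℝ}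
    (hD0 : 0 ≤ D) (hD : ∀ h ∈ lune kF k, |g h| ≤ D) :
    ‖Ξ k • (weightedPair kF g k * bStar kF (-k))‖ ≤
      ‖Ξ k‖ * D * (fermiBall kF).card ^ 2 := by
  rw [norm_smul]
  calc ‖Ξ k‖ * ‖weightedPair kF g k * bStar kF (-k)‖
      ≤ ‖Ξ k‖ * ((D * (fermiBall kF).card) * (fermiBall kF).card) := by
        gcongr
        refine (norm_mul_le _ _).trans ?_
        gcongr
        · exact norm_weightedPair_le hB hD0 hD
        · exact norm_bStar_le hB _
    _ = _ := by ring

theorem hasSum_truncKinetic_commutator (hB : (fermiBall kF).Nonempty)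
    (hΞ : Summable fun k : NZ => ‖Ξ k.1‖) (hsymm : ∀ k, Ξ (-k) = Ξ k) {D : NZ → ℝ}
    (hD0 : ∀ k, 0 ≤ D k) (hD : ∀ k : NZ, ∀ h ∈ lune kF k.1, |pairWeight e F k.1 h| ≤ D k)
    (hΞD : Summable fun k : NZ => ‖Ξ k.1‖ * D k) :
    HasSum (fun k : NZ => Ξ k.1 • (weightedPair kF (pairWeight e F k.1) k.1 * bStar kF (-k.1)))
      (truncKinetic e F * bogCreate kF Ξ - bogCreate kF Ξ * truncKinetic e F) := by
  have hs : Summable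
      (fun k : NZ => Ξ k.1 • (weightedPair kF (pairWeight e F k.1) k.1 * bStar kF (-k.1))) :=
    Summable.of_norm_bounded (hΞD.mul_right (((fermiBall kF).card : ℝ) ^ 2))
      fun k => norm_pairTerm_le hB (hD0 k) (hD k)
  have h1 := hs.hasSum
  -- `b*_k c*_{-k}` is the reflected summand `c*_{-k} b*_k`, so both halves of the commutator agree
  have h2 := (negNZ.hasSum_iff).mpr h1
  have h3 := (h1.add h2).const_smul (1 / 2 : ℂ)
  have h4 := ((hasSum_bogCreate hB hΞ).mul_left (truncKinetic e F)).sub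
    ((hasSum_bogCreate hB hΞ).mul_right (truncKinetic e F))
  have h5 := h4.unique (h3.congr_fun ?_)
  · rw [h5]
    convert h1 using 1
    rw [← two_smul ℂ, smul_smul]
    norm_num
  · intro k
    simp only [Function.comp_apply, negNZ, Equiv.coe_fn_mk, hsymm, neg_neg, mul_smul_comm,
      smul_mul_assoc, ← smul_sub, ← smul_add]
    congr 2
    rw [(weightedPair_commute_bStar kF _ (-k.1) k.1).eq, ← mul_assoc,
      truncKinetic_commutator_bStar, add_mul, mul_assoc, truncKinetic_commutator_bStar, mul_add,
      mul_assoc]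
    abel

theorem truncKinetic_commutator_bogGen :
    truncKinetic e F * bogGen kF Ξ - bogGen kF Ξ * truncKinetic e F =
      (truncKinetic e F * bogCreate kF Ξ - bogCreate kF Ξ * truncKinetic e F)
      + star (truncKinetic e F * bogCreate kF Ξ - bogCreate kF Ξ * truncKinetic e F) := by
  rw [star_sub, star_mul, star_mul, star_truncKinetic, bogGen,
    ← ContinuousLinearMap.star_eq_adjoint, mul_sub, sub_mul]
  abel

theorem norm_truncKinetic_commutator_le (hB : (fermiBall kF).Nonempty)
    (hΞ : Summable fun k : NZ => ‖Ξ k.1‖) (hsymm : ∀ k, Ξ (-k) = Ξ k) {D : NZ → ℝ}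
    (hD0 : ∀ k, 0 ≤ D k) (hD : ∀ k : NZ, ∀ h ∈ lune kF k.1, |pairWeight e F k.1 h| ≤ D k)
    (hΞD : Summable fun k : NZ => ‖Ξ k.1‖ * D k) :
    ‖truncKinetic e F * bogGen kF Ξ - bogGen kF Ξ * truncKinetic e F‖ ≤
      2 * ∑' k : NZ, ‖Ξ k.1‖ * D k * (fermiBall kF).card ^ 2 := by
  have h := hasSum_truncKinetic_commutator hB hΞ hsymm hD0 hD hΞD
  rw [truncKinetic_commutator_bogGen, ← h.tsum_eq, two_mul]
  have h2 := tsum_of_norm_bounded (hΞD.mul_right (((fermiBall kF).card : ℝ) ^ 2)).hasSum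
    fun k => norm_pairTerm_le (Ξ := Ξ) hB (hD0 k) (hD k)
  exact (norm_add_le _ _).trans (add_le_add h2 ((norm_star _).trans_le h2))

/-- The truncated kinetic energy of the trial state is bounded uniformly in the truncation. -/
theorem norm_truncKinetic_bogT_le (hB : (fermiBall kF).Nonempty)
    (hΞ : Summable fun k : NZ => ‖Ξ k.1‖) (hsymm : ∀ k, Ξ (-k) = Ξ k) {D : NZ → ℝ}
    (hD0 : ∀ k, 0 ≤ D k) (hD : ∀ k : NZ, ∀ h ∈ lune kF k.1, |pairWeight e F k.1 h| ≤ D k)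
    (hΞD : Summable fun k : NZ => ‖Ξ k.1‖ * D k) :
    ‖truncKinetic e F (bogT kF Ξ 1 vacuum)‖ ≤
      2 * ∑' k : NZ, ‖Ξ k.1‖ * D k * (fermiBall kF).card ^ 2 := by
  have hsk := star_bogGen kF Ξ
  have hd := hasDerivAt_conj_apply (B := bogGen kF Ξ) (truncKinetic e F) vacuum
  have key := norm_image_sub_le_of_norm_deriv_le_segment' (a := 0) (b := 1)
    (fun t _ => (hd t).hasDerivWithinAt) (fun t _ => ?_) 1 (Set.right_mem_Icc.mpr zero_le_one)
    (C := 2 * ∑' k : NZ, ‖Ξ k.1‖ * D k * (fermiBall kF).card ^ 2)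
  · simp only [expGroup_zero, one_apply_eq_self, truncKinetic_vacuum, map_zero, sub_zero, mul_one,
      norm_expGroup_apply hsk] at key
    exact key
  · rw [norm_expGroup_apply hsk]
    refine (ContinuousLinearMap.le_opNorm _ _).trans ?_
    rw [norm_expGroup_apply hsk, norm_vacuum, mul_one]
    exact norm_truncKinetic_commutator_le hB hΞ hsymm hD0 hD hΞD

theorem continuous_bogT_apply (kF : ℝ) (Ξ : Mode → ℂ) (φ : Fock) :
    Continuous fun t : ℝ => bogT kF Ξ t φ := by
  have h : Continuous fun t : ℝ => bogT kF Ξ t := continuous_iff_continuousAt.mpr fun t =>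
    (hasDerivAt_expGroup (B := bogGen kF Ξ) t).continuousAt
  exact h.clm_apply continuous_const

theorem norm_pairIntegrand_le (hB : (fermiBall kF).Nonempty) {g : Mode → ℝ} {k : Mode} {D : ℝ}
    (hD0 : 0 ≤ D) (hD : ∀ h ∈ lune kF k, |g h| ≤ D) (t : ℝ) :
    ‖2 * (Ξ k * ⟪star (weightedPair kF g k) (bogT kF Ξ t vacuum),
      bStar kF (-k) (bogT kF Ξ t vacuum)⟫_ℂ).re‖ ≤
      2 * (‖Ξ k‖ * D * (fermiBall kF).card ^ 2) := by
  have hn : ‖bogT kF Ξ t vacuum‖ = 1 := by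
    rw [bogT_eq_expGroup, norm_expGroup_apply (star_bogGen kF Ξ), norm_vacuum]
  rw [Real.norm_eq_abs, abs_mul, abs_two]
  gcongr
  refine (Complex.abs_re_le_norm _).trans ?_
  rw [norm_mul, mul_assoc]
  gcongr
  refine (norm_inner_le_norm _ _).trans ?_
  have h1 := ContinuousLinearMap.le_opNorm (star (weightedPair kF g k)) (bogT kF Ξ t vacuum)
  have h2 := ContinuousLinearMap.le_opNorm (bStar kF (-k)) (bogT kF Ξ t vacuum)
  rw [hn, mul_one] at h1 h2
  replace h1 := h1.trans ((norm_star _).trans_le (norm_weightedPair_le hB hD0 hD))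
  replace h2 := h2.trans (norm_bStar_le hB _)
  calc _ ≤ (D * (fermiBall kF).card) * (fermiBall kF).card := by gcongr
    _ = _ := by ring

theorem abs_pairEnergy_le (hB : (fermiBall kF).Nonempty) {g : Mode → ℝ} {k : Mode} {D : ℝ}
    (hD0 : 0 ≤ D) (hD : ∀ h ∈ lune kF k, |g h| ≤ D) :
    |pairEnergy kF Ξ g k| ≤ 2 * (‖Ξ k‖ * D * (fermiBall kF).card ^ 2) := by
  have := intervalIntegral.norm_integral_le_of_norm_le_const (a := 0) (b := 1)
    fun t (_ : t ∈ Set.uIoc (0 : ℝ) 1) => norm_pairIntegrand_le (Ξ := Ξ) hB hD0 hD t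
  simpa [pairEnergy] using this

/-- The truncated kinetic energy of the trial state is the sum of the pair energies. -/
theorem hasSum_pairEnergy_truncKinetic (hB : (fermiBall kF).Nonempty)
    (hΞ : Summable fun k : NZ => ‖Ξ k.1‖) (hsymm : ∀ k, Ξ (-k) = Ξ k) {D : NZ → ℝ}
    (hD0 : ∀ k, 0 ≤ D k) (hD : ∀ k : NZ, ∀ h ∈ lune kF k.1, |pairWeight e F k.1 h| ≤ D k)
    (hΞD : Summable fun k : NZ => ‖Ξ k.1‖ * D k) :
    HasSum (fun k : NZ => pairEnergy kF Ξ (pairWeight e F k.1) k.1)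
      (⟪bogT kF Ξ 1 vacuum, truncKinetic e F (bogT kF Ξ 1 vacuum)⟫_ℂ).re := by
  have hsk := star_bogGen kF Ξ
  set C := truncKinetic e F * bogGen kF Ξ - bogGen kF Ξ * truncKinetic e F with hC
  have hcont := continuous_bogT_apply kF Ξ vacuum
  have hd : ∀ t, HasDerivAt
      (fun t => (⟪vacuum, expGroup (bogGen kF Ξ) (-t)
        (truncKinetic e F (bogT kF Ξ t vacuum))⟫_ℂ).re)
      (⟪bogT kF Ξ t vacuum, C (bogT kF Ξ t vacuum)⟫_ℂ).re t := by
    intro t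
    have h1 := hasDerivAt_conj_apply (B := bogGen kF Ξ) (truncKinetic e F) vacuum t
    have h2 := ((Complex.reCLM.comp
      ((innerSL ℂ vacuum).restrictScalars ℝ)).hasFDerivAt.comp_hasDerivAt t h1)
    refine HasDerivAt.congr_deriv h2 ?_
    rw [← inner_expGroup hsk (-t) (bogT kF Ξ t vacuum)]
    have : expGroup (bogGen kF Ξ) (-t) (bogT kF Ξ t vacuum) = vacuum := by
      rw [bogT_eq_expGroup, ← mul_apply_eq_comp, expGroup_neg_mul, one_apply_eq_self]
    rw [this]
    rfl
  have hE : ∫ t in (0 : ℝ)..1, (⟪bogT kF Ξ t vacuum, C (bogT kF Ξ t vacuum)⟫_ℂ).re =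
      (⟪bogT kF Ξ 1 vacuum, truncKinetic e F (bogT kF Ξ 1 vacuum)⟫_ℂ).re := by
    rw [intervalIntegral.integral_eq_sub_of_hasDerivAt (fun t _ => hd t)
      (Continuous.intervalIntegrable (by fun_prop) _ _)]
    have h0 : bogT kF Ξ 0 vacuum = vacuum := by
      rw [bogT_eq_expGroup, expGroup_zero, one_apply_eq_self]
    have h1 : vacuum = expGroup (bogGen kF Ξ) (-1) (bogT kF Ξ 1 vacuum) := by
      rw [bogT_eq_expGroup, ← mul_apply_eq_comp, expGroup_neg_mul, one_apply_eq_self]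
    rw [h0, truncKinetic_vacuum, map_zero, inner_zero_right, Complex.zero_re, sub_zero]
    conv_lhs => rw [h1, inner_expGroup hsk, ← h1]
  rw [← hE]
  refine intervalIntegral.hasSum_integral_of_dominated_convergence
    (fun k _ => 2 * (‖Ξ k.1‖ * D k * (fermiBall kF).card ^ 2))
    (fun k => Continuous.aestronglyMeasurable (by fun_prop))
    (fun k => MeasureTheory.ae_of_all _ fun t _ => norm_pairIntegrand_le hB (hD0 k) (hD k) t)
    (MeasureTheory.ae_of_all _ fun t _ => (hΞD.mul_right _).mul_left 2)
    intervalIntegrable_const (MeasureTheory.ae_of_all _ fun t _ => ?_)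
  have hs := hasSum_truncKinetic_commutator hB hΞ hsymm hD0 hD hΞD
  set ψ := bogT kF Ξ t vacuum
  have h1 := (Complex.reCLM.hasSum ((innerSL ℂ ψ).hasSum
    ((ContinuousLinearMap.apply ℂ Fock ψ).hasSum hs))).mul_left 2
  rw [hC, truncKinetic_commutator_bogGen, add_apply, inner_add_right,
    ContinuousLinearMap.star_eq_adjoint, ContinuousLinearMap.adjoint_inner_right, Complex.add_re,
    ← inner_conj_symm (_ : Fock) ψ, Complex.conj_re, ← two_mul]
  refine h1.congr_fun fun k => ?_
  simp only [ContinuousLinearMap.apply_apply, smul_apply, mul_apply_eq_comp,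
    innerSL_apply_apply, inner_smul_right, Complex.reCLM_apply,
    ContinuousLinearMap.star_eq_adjoint, ContinuousLinearMap.adjoint_inner_left]

end Truncated

/-! ### Conservation of the difference of particle and hole numbers -/

/-- The number of holes minus the number of particles in a configuration. -/
def imbalance (kF : ℝ) (S : Finset Mode) : ℤ := ∑ q ∈ S, if q ∈ fermiBall kF then 1 else -1

/-- The states with equally many particles and holes. -/
def balancedSpace (kF : ℝ) : Submodule ℂ Fock where
  carrier := {ψ | ∀ S, imbalance kF S ≠ 0 → ψ S = 0}
  add_mem' := by
    intro ψ φ hψ hφ S hS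
    simp [hψ S hS, hφ S hS]
  zero_mem' := by
    intro S _
    simp
  smul_mem' := by
    intro c ψ hψ S hS
    simp [hψ S hS]

theorem mem_balancedSpace {kF : ℝ} {ψ : Fock} :
    ψ ∈ balancedSpace kF ↔ ∀ S, imbalance kF S ≠ 0 → ψ S = 0 := Iff.rfl

theorem vacuum_mem_balancedSpace (kF : ℝ) : vacuum ∈ balancedSpace kF := by
  intro S hS
  rw [vacuum, lp.single_apply, Pi.single_eq_of_ne]
  rintro rfl
  simp [imbalance] at hS

theorem balancedSpace_hasSum {ι : Type*} {kF : ℝ} {f : ι → Fock} {a : Fock} (h : HasSum f a)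
    (hf : ∀ i, f i ∈ balancedSpace kF) : a ∈ balancedSpace kF := by
  intro S hS
  have h1 := (lp.evalCLM ℂ (fun _ : Finset Mode => ℂ) 2 S).hasSum h
  have h2 : HasSum (fun i => lp.evalCLM ℂ (fun _ : Finset Mode => ℂ) 2 S (f i)) 0 := by
    convert hasSum_zero using 1
    ext i
    exact hf i S hS
  exact h1.unique h2

/-- A holes-and-particles configuration without imbalance has at most `2N` elements, as there are
only `N` holes. -/
theorem card_le_of_imbalance_eq_zero {kF : ℝ} {S : Finset Mode} (h : imbalance kF S = 0) :
    S.card ≤ 2 * (fermiBall kF).card := by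
  have h1 : (S.filter fun q => q ∈ fermiBall kF).card ≤ (fermiBall kF).card :=
    Finset.card_le_card fun q hq => (Finset.mem_filter.mp hq).2
  have h2 := Finset.card_filter_add_card_filter_not (s := S) fun q => q ∈ fermiBall kF
  rw [imbalance, Finset.sum_ite] at h
  simp only [Finset.sum_const, nsmul_eq_mul, mul_one, mul_neg] at h
  omega

theorem weightedPair_mem_balancedSpace {kF : ℝ} {g : Mode → ℝ} {k : Mode} {ψ : Fock}
    (hψ : ψ ∈ balancedSpace kF) : weightedPair kF g k ψ ∈ balancedSpace kF := by
  rw [weightedPair, smul_apply, sum_apply]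
  refine Submodule.smul_mem _ _ (Submodule.sum_mem _ fun h hh => ?_)
  rw [smul_apply]
  refine Submodule.smul_mem _ _ fun S hS => ?_
  rw [create_mul_create_apply]
  split_ifs with hm
  · rw [hψ, mul_zero]
    have e1 := Finset.add_sum_erase S (fun q => if q ∈ fermiBall kF then (1 : ℤ) else -1) hm.1
    have e2 := Finset.add_sum_erase _ (fun q => if q ∈ fermiBall kF then (1 : ℤ) else -1) hm.2
    simp only [(mem_lune.mp hh).1, (mem_lune.mp hh).2, if_true, if_false] at e1 e2
    simp only [imbalance] at hS ⊢
    omega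
  · rfl

theorem star_weightedPair_mem_balancedSpace {kF : ℝ} {g : Mode → ℝ} {k : Mode} {ψ : Fock}
    (hψ : ψ ∈ balancedSpace kF) : star (weightedPair kF g k) ψ ∈ balancedSpace kF := by
  rw [star_weightedPair, smul_apply, sum_apply]
  refine Submodule.smul_mem _ _ (Submodule.sum_mem _ fun h hh => ?_)
  rw [smul_apply]
  refine Submodule.smul_mem _ _ fun S hS => ?_
  rw [annihilate_mul_annihilate_apply]
  split_ifs with hm
  · rw [hψ, mul_zero]
    simp only [imbalance] at hS ⊢
    rw [Finset.sum_insert hm.2, Finset.sum_insert hm.1]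
    simp only [(mem_lune.mp hh).1, (mem_lune.mp hh).2, if_true, if_false]
    omega
  · rfl

section Flow

variable {kF : ℝ} {Ξ : Mode → ℂ}

theorem bogGen_mem_balancedSpace (hB : (fermiBall kF).Nonempty)
    (hΞ : Summable fun k : NZ => ‖Ξ k.1‖) {ψ : Fock} (hψ : ψ ∈ balancedSpace kF) :
    bogGen kF Ξ ψ ∈ balancedSpace kF := by
  have h1 := hasSum_bogCreate hB hΞ
  rw [bogGen, ← ContinuousLinearMap.star_eq_adjoint, sub_apply]
  refine Submodule.sub_mem _
    (balancedSpace_hasSum ((ContinuousLinearMap.apply ℂ Fock ψ).hasSum h1) fun k => ?_)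
    (balancedSpace_hasSum ((ContinuousLinearMap.apply ℂ Fock ψ).hasSum h1.star) fun k => ?_)
  · rw [ContinuousLinearMap.apply_apply, smul_apply, smul_apply, mul_apply_eq_comp]
    refine Submodule.smul_mem _ _ (Submodule.smul_mem _ _ ?_)
    rw [bStar_eq_weightedPair, bStar_eq_weightedPair]
    exact weightedPair_mem_balancedSpace (weightedPair_mem_balancedSpace hψ)
  · rw [ContinuousLinearMap.apply_apply, star_smul, star_smul, star_mul, smul_apply, smul_apply,
      mul_apply_eq_comp]
    refine Submodule.smul_mem _ _ (Submodule.smul_mem _ _ ?_)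
    rw [bStar_eq_weightedPair, bStar_eq_weightedPair]
    exact star_weightedPair_mem_balancedSpace (star_weightedPair_mem_balancedSpace hψ)

theorem bogT_vacuum_mem_balancedSpace (hB : (fermiBall kF).Nonempty)
    (hΞ : Summable fun k : NZ => ‖Ξ k.1‖) (t : ℝ) :
    bogT kF Ξ t vacuum ∈ balancedSpace kF := by
  have h1 := NormedSpace.exp_series_hasSum_exp' (𝕂 := ℂ) ((t : ℂ) • bogGen kF Ξ)
  refine balancedSpace_hasSum ((ContinuousLinearMap.apply ℂ Fock vacuum).hasSum h1) fun n => ?_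
  rw [ContinuousLinearMap.apply_apply, smul_apply]
  refine Submodule.smul_mem _ _ ?_
  induction n with
  | zero => simpa using vacuum_mem_balancedSpace kF
  | succ n ih =>
    rw [pow_succ', mul_apply_eq_comp, smul_apply]
    exact Submodule.smul_mem _ _ (bogGen_mem_balancedSpace hB hΞ ih)

theorem norm_bogT_vacuum (kF : ℝ) (Ξ : Mode → ℂ) (t : ℝ) : ‖bogT kF Ξ t vacuum‖ = 1 := by
  rw [bogT_eq_expGroup, norm_expGroup_apply (star_bogGen kF Ξ), norm_vacuum]

theorem summable_norm_sq (ψ : Fock) : Summable fun S => ‖ψ S‖ ^ 2 := by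
  simpa using (lp.memℓp ψ).summable (by norm_num)

theorem mem_domain_numberPlusTwoPow {ψ : Fock} (hψ : ψ ∈ balancedSpace kF) :
    ψ ∈ numberPlusTwoPow.domain := by
  refine memℓp_gen ?_
  refine Summable.of_nonneg_of_le (fun _ => by positivity) (fun S => ?_)
    ((summable_norm_sq ψ).mul_left ((((2 * (fermiBall kF).card : ℝ) + 2) ^ (3 / 2 : ℝ)) ^ 2))
  simp only [ENNReal.toReal_ofNat, Real.rpow_ofNat, norm_mul, mul_pow]
  by_cases h : imbalance kF S = 0
  · have hc : (S.card : ℝ) ≤ 2 * (fermiBall kF).card := by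
      exact_mod_cast card_le_of_imbalance_eq_zero h
    rw [Complex.norm_real, Real.norm_eq_abs, abs_of_nonneg (by positivity)]
    gcongr
  · simp [mem_balancedSpace.mp hψ S h]

theorem enorm_numberPlusTwoPow_sq {ψ : Fock} (hψ : ψ ∈ numberPlusTwoPow.domain) :
    ‖numberPlusTwoPow ⟨ψ, hψ⟩‖ₑ ^ 2 =
      numberMoment (fun n => ((n + 2 : ℕ) : ENNReal) ^ 3) ψ := by
  rw [← numberMoment_one]
  refine tsum_congr fun S => ?_
  have h : (numberPlusTwoPow ⟨ψ, hψ⟩ : Fock) S =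
      ((((S.card : ℝ) + 2) ^ (3 / 2 : ℝ) : ℝ) : ℂ) * ψ S := rfl
  rw [h, enorm_mul, mul_pow, one_mul]
  congr 1
  rw [← ofReal_norm, Complex.norm_real, Real.norm_eq_abs, abs_of_nonneg (by positivity),
    ← ENNReal.ofReal_pow (by positivity), ← Real.rpow_natCast, ← Real.rpow_mul (by positivity)]
  norm_num
  rw [ENNReal.ofReal_pow (by positivity), ENNReal.ofReal_add (by positivity) (by positivity)]
  simp

/-- A crude bound on `(𝒩 + 2)^{3/2}` where `𝒩 ≤ 2N`; it only serves to show that `M` is finite. -/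
theorem norm_numberPlusTwoPow_le {ψ : Fock} (hb : ψ ∈ balancedSpace kF)
    (hψ : ψ ∈ numberPlusTwoPow.domain) :
    ‖numberPlusTwoPow ⟨ψ, hψ⟩‖ ≤ (2 * (fermiBall kF).card + 2) ^ 2 * ‖ψ‖ := by
  refine le_of_sq_le_sq ?_ (by positivity)
  rw [← ENNReal.ofReal_le_ofReal_iff (by positivity), ENNReal.ofReal_pow (norm_nonneg _),
    ofReal_norm, enorm_numberPlusTwoPow_sq hψ, mul_pow, ENNReal.ofReal_mul (by positivity),
    ENNReal.ofReal_pow (norm_nonneg ψ), ofReal_norm, ← numberMoment_one, numberMoment, numberMoment,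
    ← ENNReal.tsum_mul_left]
  refine ENNReal.tsum_le_tsum fun S => ?_
  by_cases h : imbalance kF S = 0
  · rw [one_mul]
    gcongr
    have hc := card_le_of_imbalance_eq_zero h
    have h1 : ENNReal.ofReal (((2 * (fermiBall kF).card + 2) ^ 2) ^ 2) =
        (((2 * (fermiBall kF).card + 2) ^ 4 : ℕ) : ENNReal) := by
      rw [← ENNReal.ofReal_natCast]
      congr 1
      push_cast
      ring
    rw [h1]
    have h2 : (S.card + 2) ^ 3 ≤ (2 * (fermiBall kF).card + 2) ^ 4 :=
      (Nat.pow_le_pow_left (by omega) 3).trans (Nat.pow_le_pow_right (by omega) (by norm_num))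
    exact_mod_cast h2
  · simp [mem_balancedSpace.mp hb S h]

end Flow

/-! ### Removing the truncation of the kinetic energy -/

/-- The one-particle energies of `kineticOp`. -/
def modeEnergy (N : ℕ) (kF : ℝ) (p : Mode) : ℝ :=
  if p ∈ fermiBall kF then -(hbar N ^ 2 * ‖vec p‖ ^ 2) else hbar N ^ 2 * ‖vec p‖ ^ 2

/-- The kinetic energy of `S` in `kineticOp`. -/
def configEnergy (N : ℕ) (kF : ℝ) (S : Finset Mode) : ℝ := ∑ p ∈ S, modeEnergy N kF p

/-- The energy `ħ² k · (p + h)` of the pair `(p, h) = (h + k, h)`. -/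
def kineticWeight (N : ℕ) (k h : Mode) : ℝ := hbar N ^ 2 * ⟪vec k, vec (h + k) + vec h⟫_ℝ

section Energy

variable {N : ℕ} {kF : ℝ}

theorem pairMean_kineticWeight (k : Mode) :
    pairMean kF (kineticWeight N k) k = hbar N ^ 2 * kDotF kF k := by
  simp only [pairMean, kineticWeight, kDotF, fVec, inner_smul_right, inner_sum, ← Finset.mul_sum]
  ring

theorem abs_modeEnergy (p : Mode) : |modeEnergy N kF p| = hbar N ^ 2 * ‖vec p‖ ^ 2 := by
  unfold modeEnergy
  split_ifs
  · rw [abs_neg, abs_of_nonneg (by positivity)]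
  · rw [abs_of_nonneg (by positivity)]

theorem modeEnergy_pair {k h : Mode} (hh : h ∈ lune kF k) :
    modeEnergy N kF (h + k) + modeEnergy N kF h = kineticWeight N k h := by
  obtain ⟨h1, h2⟩ := mem_lune.mp hh
  rw [modeEnergy, modeEnergy, if_neg h2, if_pos h1, kineticWeight, vec_add, inner_add_right,
    inner_add_right, norm_add_sq_real, real_inner_self_eq_norm_sq, real_inner_comm (vec k) (vec h)]
  ring

theorem abs_pairWeight_le (hkF : 0 ≤ kF) (F : Finset Mode) {k h : Mode} (hk : k ≠ 0)
    (hh : h ∈ lune kF k) :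
    |pairWeight (modeEnergy N kF) F k h| ≤ hbar N ^ 2 * (2 * (kF + 1) ^ 2) * ‖vec k‖ ^ 2 := by
  have hh' := mem_fermiBall.mp (mem_lune.mp hh).1
  have hk1 := one_le_norm_vec hk
  have h1 : ‖vec (h + k)‖ ≤ (kF + 1) * ‖vec k‖ := by
    rw [vec_add]
    refine (norm_add_le _ _).trans ?_
    nlinarith
  have h2 : ‖vec h‖ ≤ (kF + 1) * ‖vec k‖ := by nlinarith
  have hite : ∀ q, |if q ∈ F then modeEnergy N kF q else 0| ≤ hbar N ^ 2 * ‖vec q‖ ^ 2 := by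
    intro q
    split_ifs
    · rw [abs_modeEnergy]
    · rw [abs_zero]; positivity
  calc |pairWeight (modeEnergy N kF) F k h|
      ≤ hbar N ^ 2 * ‖vec (h + k)‖ ^ 2 + hbar N ^ 2 * ‖vec h‖ ^ 2 :=
        (abs_add_le _ _).trans (add_le_add (hite _) (hite _))
    _ ≤ hbar N ^ 2 * ((kF + 1) * ‖vec k‖) ^ 2 + hbar N ^ 2 * ((kF + 1) * ‖vec k‖) ^ 2 := by
        gcongr
    _ = _ := by ring

theorem pairEnergy_congr {Ξ : Mode → ℂ} {g g' : Mode → ℝ} {k : Mode}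
    (h : ∀ q ∈ lune kF k, g q = g' q) : pairEnergy kF Ξ g k = pairEnergy kF Ξ g' k := by
  have : weightedPair kF g k = weightedPair kF g' k := by
    rw [weightedPair, weightedPair, Finset.sum_congr rfl fun q hq => by rw [h q hq]]
  rw [pairEnergy, pairEnergy, this]

theorem eventually_pairEnergy_eq (Ξ : Mode → ℂ) (k : Mode) :
    ∀ᶠ F : Finset Mode in Filter.atTop,
      pairEnergy kF Ξ (pairWeight (modeEnergy N kF) F k) k =
        pairEnergy kF Ξ (kineticWeight N k) k := by
  filter_upwards [Filter.eventually_ge_atTop (lune kF k ∪ (lune kF k).image (· + k))] with F hF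
  refine pairEnergy_congr fun h hh => ?_
  have h1 : h ∈ F := hF (Finset.mem_union_left _ hh)
  have h2 : h + k ∈ F := hF (Finset.mem_union_right _ (Finset.mem_image_of_mem _ hh))
  rw [pairWeight, if_pos h1, if_pos h2, modeEnergy_pair hh]

/-- Beyond the Fermi ball all energies are nonnegative, so the truncated energies of a
configuration are controlled by the full one. -/
theorem abs_truncEnergy_le {F : Finset Mode} (hF : fermiBall kF ⊆ F) (S : Finset Mode) :
    |∑ q ∈ S, if q ∈ F then modeEnergy N kF q else 0| ≤
      |configEnergy N kF S| + ∑ q ∈ fermiBall kF, hbar N ^ 2 * ‖vec q‖ ^ 2 := by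
  have h1 : (∑ q ∈ S, if q ∈ F then modeEnergy N kF q else 0) ≤ configEnergy N kF S := by
    refine Finset.sum_le_sum fun q _ => ?_
    split_ifs with hq
    · exact le_rfl
    · rw [modeEnergy, if_neg fun h => hq (hF h)]; positivity
  have h2 : -∑ q ∈ fermiBall kF, hbar N ^ 2 * ‖vec q‖ ^ 2 ≤
      ∑ q ∈ S, if q ∈ F then modeEnergy N kF q else 0 := by
    calc -∑ q ∈ fermiBall kF, hbar N ^ 2 * ‖vec q‖ ^ 2
        ≤ -∑ q ∈ S.filter (· ∈ fermiBall kF), hbar N ^ 2 * ‖vec q‖ ^ 2 := by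
          refine neg_le_neg (Finset.sum_le_sum_of_subset_of_nonneg
            (fun q hq => (Finset.mem_filter.mp hq).2) fun _ _ _ => by positivity)
      _ = ∑ q ∈ S, if q ∈ fermiBall kF then -(hbar N ^ 2 * ‖vec q‖ ^ 2) else 0 := by
          rw [Finset.sum_filter, ← Finset.sum_neg_distrib]
          refine Finset.sum_congr rfl fun q _ => ?_
          split_ifs <;> simp
      _ ≤ _ := by
          refine Finset.sum_le_sum fun q _ => ?_
          by_cases hq : q ∈ fermiBall kF
          · rw [if_pos hq, if_pos (hF hq), modeEnergy, if_pos hq]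
          · rw [if_neg hq]
            split_ifs
            · rw [modeEnergy, if_neg hq]; positivity
            · exact le_rfl
  have h3 : 0 ≤ ∑ q ∈ fermiBall kF, hbar N ^ 2 * ‖vec q‖ ^ 2 :=
    Finset.sum_nonneg fun _ _ => by positivity
  rw [abs_le]
  constructor
  · linarith [abs_nonneg (configEnergy N kF S)]
  · linarith [le_abs_self (configEnergy N kF S)]

theorem eventually_truncEnergy_eq (S : Finset Mode) :
    ∀ᶠ F : Finset Mode in Filter.atTop,
      (∑ q ∈ S, if q ∈ F then modeEnergy N kF q else 0) = configEnergy N kF S := by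
  filter_upwards [Filter.eventually_ge_atTop S] with F hF
  exact Finset.sum_congr rfl fun q hq => if_pos (hF hq)

/-- A vector on which the truncated kinetic energies are uniformly bounded lies in the domain of the
kinetic energy. -/
theorem mem_domain_kineticOp {ψ : Fock} {C : ℝ}
    (h : ∀ F, ‖truncKinetic (modeEnergy N kF) F ψ‖ ≤ C) : ψ ∈ (kineticOp N kF).domain := by
  refine lp.memℓp_of_tendsto (l := Filter.atTop)
    (F := fun F => truncKinetic (modeEnergy N kF) F ψ) ?_ ?_
  · rw [isBounded_iff_forall_norm_le]
    exact ⟨C, by rintro _ ⟨F, rfl⟩; exact h F⟩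
  · rw [tendsto_pi_nhds]
    intro S
    refine tendsto_nhds_of_eventually_eq ?_
    filter_upwards [eventually_truncEnergy_eq (N := N) (kF := kF) S] with F hF
    change truncKinetic (modeEnergy N kF) F ψ S = _
    rw [truncKinetic_apply, hF]
    rfl

theorem kineticOp_apply {ψ : Fock} (hψ : ψ ∈ (kineticOp N kF).domain) (S : Finset Mode) :
    (kineticOp N kF ⟨ψ, hψ⟩ : Fock) S = (configEnergy N kF S : ℂ) * ψ S := rfl

theorem inner_mul_ofReal (z : ℂ) (r : ℝ) : ⟪z, (r : ℂ) * z⟫_ℂ = ((r * ‖z‖ ^ 2 : ℝ) : ℂ) := by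
  rw [RCLike.inner_apply, mul_assoc, Complex.mul_conj']
  push_cast
  ring

theorem inner_kineticOp {ψ : Fock} (hψ : ψ ∈ (kineticOp N kF).domain) :
    ⟪ψ, kineticOp N kF ⟨ψ, hψ⟩⟫_ℂ = ((∑' S, configEnergy N kF S * ‖ψ S‖ ^ 2 : ℝ) : ℂ) := by
  rw [lp.inner_eq_tsum, Complex.ofReal_tsum]
  refine tsum_congr fun S => ?_
  rw [kineticOp_apply, inner_mul_ofReal]

theorem tendsto_inner_truncKinetic {ψ : Fock} (hψ : ψ ∈ (kineticOp N kF).domain) :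
    Filter.Tendsto (fun F => (⟪ψ, truncKinetic (modeEnergy N kF) F ψ⟫_ℂ).re) Filter.atTop
      (nhds (∑' S, configEnergy N kF S * ‖ψ S‖ ^ 2)) := by
  have hF : ∀ F, (⟪ψ, truncKinetic (modeEnergy N kF) F ψ⟫_ℂ).re =
      ∑' S, (∑ q ∈ S, if q ∈ F then modeEnergy N kF q else 0) * ‖ψ S‖ ^ 2 := by
    intro F
    rw [lp.inner_eq_tsum, ← Complex.ofReal_re (∑' S, _ * ‖ψ S‖ ^ 2), Complex.ofReal_tsum]
    congr 1
    refine tsum_congr fun S => ?_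
    rw [truncKinetic_apply, inner_mul_ofReal]
  simp only [hF]
  set C := ∑ q ∈ fermiBall kF, hbar N ^ 2 * ‖vec q‖ ^ 2
  have hs := (summable_norm_sq (kineticOp N kF ⟨ψ, hψ⟩)).add
    ((summable_norm_sq ψ).mul_left (1 + C))
  refine tendsto_tsum_of_dominated_convergence hs (fun S => ?_) ?_
  · refine tendsto_nhds_of_eventually_eq ?_
    filter_upwards [eventually_truncEnergy_eq (N := N) (kF := kF) S] with F hF
    rw [hF]
  · filter_upwards [Filter.eventually_ge_atTop (fermiBall kF)] with F hF S
    have h1 := abs_truncEnergy_le (N := N) hF S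
    rw [norm_mul, norm_pow, norm_norm, Real.norm_eq_abs, kineticOp_apply, norm_mul, mul_pow,
      Complex.norm_real, Real.norm_eq_abs]
    calc _ ≤ (|configEnergy N kF S| + C) * ‖ψ S‖ ^ 2 := by gcongr
      _ ≤ (|configEnergy N kF S| ^ 2 + 1 + C) * ‖ψ S‖ ^ 2 := by
          gcongr
          nlinarith [sq_nonneg (|configEnergy N kF S| - 1), abs_nonneg (configEnergy N kF S)]
      _ = _ := by ring

section Limit

variable {Ξ : Mode → ℂ}

theorem bogT_vacuum_mem_domain_kineticOp (hkF : 0 ≤ kF) (hB : (fermiBall kF).Nonempty)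
    (hΞ : Summable fun k : NZ => ‖Ξ k.1‖) (hsymm : ∀ k, Ξ (-k) = Ξ k)
    (hΞ2 : Summable fun k : NZ => ‖vec k.1‖ ^ 2 * ‖Ξ k.1‖) :
    bogT kF Ξ 1 vacuum ∈ (kineticOp N kF).domain := by
  refine mem_domain_kineticOp fun F => norm_truncKinetic_bogT_le hB hΞ hsymm
    (D := fun k => hbar N ^ 2 * (2 * (kF + 1) ^ 2) * ‖vec k.1‖ ^ 2) (fun k => by positivity)
    (fun k h hh => abs_pairWeight_le hkF F k.2 hh) ?_
  refine (hΞ2.mul_left (hbar N ^ 2 * (2 * (kF + 1) ^ 2))).congr fun k => ?_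
  ring

/-- The kinetic energy of the trial state is the sum of the energies of the pair modes. -/
theorem inner_kineticOp_bogT (hkF : 0 ≤ kF) (hB : (fermiBall kF).Nonempty)
    (hΞ : Summable fun k : NZ => ‖Ξ k.1‖) (hsymm : ∀ k, Ξ (-k) = Ξ k)
    (hΞ2 : Summable fun k : NZ => ‖vec k.1‖ ^ 2 * ‖Ξ k.1‖)
    (hH : bogT kF Ξ 1 vacuum ∈ (kineticOp N kF).domain) :
    ⟪bogT kF Ξ 1 vacuum, kineticOp N kF ⟨bogT kF Ξ 1 vacuum, hH⟩⟫_ℂ =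
      ((∑' k : NZ, pairEnergy kF Ξ (kineticWeight N k.1) k.1 : ℝ) : ℂ) := by
  rw [inner_kineticOp]
  congr 1
  refine tendsto_nhds_unique (tendsto_inner_truncKinetic hH) ?_
  have hs : Summable fun k : NZ =>
      ‖Ξ k.1‖ * (hbar N ^ 2 * (2 * (kF + 1) ^ 2) * ‖vec k.1‖ ^ 2) :=
    (hΞ2.mul_left (hbar N ^ 2 * (2 * (kF + 1) ^ 2))).congr fun k => by ring
  have hF := fun F => (hasSum_pairEnergy_truncKinetic (F := F) (e := modeEnergy N kF) hB hΞ hsymm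
    (D := fun k => hbar N ^ 2 * (2 * (kF + 1) ^ 2) * ‖vec k.1‖ ^ 2) (fun k => by positivity)
    (fun k h hh => abs_pairWeight_le hkF F k.2 hh) hs).tsum_eq
  simp only [← hF]
  refine tendsto_tsum_of_dominated_convergence
    ((hs.mul_right (((fermiBall kF).card : ℝ) ^ 2)).mul_left 2) (fun k => ?_)
    (Filter.Eventually.of_forall fun F k => ?_)
  · exact tendsto_nhds_of_eventually_eq (eventually_pairEnergy_eq Ξ k.1)
  · rw [Real.norm_eq_abs]
    exact abs_pairEnergy_le hB (by positivity) fun h hh => abs_pairWeight_le hkF F k.2 hh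

end Limit

end Energy

/-! ### Lattice points in the Fermi ball -/

theorem norm_vec_sq (h : Mode) : ‖vec h‖ ^ 2 = ∑ i, (h i : ℝ) ^ 2 := by
  rw [EuclideanSpace.norm_sq_eq]
  simp [vec]

theorem card_le_card_fermiBall {kF : ℝ} (hkF : 0 ≤ kF) {m : ℤ} (hm : (m : ℝ) ≤ kF ^ 2)
    (A : Finset Mode) (hA : ∀ h ∈ A, ∑ i, h i ^ 2 ≤ m) : A.card ≤ (fermiBall kF).card := by
  refine Finset.card_le_card fun h hh => mem_fermiBall.mpr (le_of_sq_le_sq ?_ hkF)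
  rw [norm_vec_sq]
  refine le_trans ?_ hm
  exact_mod_cast hA h hh

/-- A lower bound on the number of lattice points in a ball. The volume of the ball suggests the
constant `3/(4π)` in place of `1.45`, which leaves room for an elementary argument: the ball contains
at least `1`, `7`, `33` points for radii from `0`, `1`, `2` on, and for larger radii an inscribed cube
has enough points. -/
theorem cube_le_card_fermiBall {kF : ℝ} (hkF : 0 ≤ kF) :
    kF ^ 3 ≤ 1.45 * (fermiBall kF).card := by
  have hcard : ∀ (m : ℤ) (n : ℤ) (c : ℕ), (m : ℝ) ≤ kF ^ 2 →
      ((Fintype.piFinset fun _ : Fin 3 => Finset.Icc (-n) n).filter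
        fun h : Mode => ∑ i, h i ^ 2 ≤ m).card = c → (c : ℝ) ≤ (fermiBall kF).card := by
    intro m n c hm hc
    rw [← hc]
    exact_mod_cast card_le_card_fermiBall hkF hm _ fun h hh => (Finset.mem_filter.mp hh).2
  rcases lt_or_ge kF 1 with h1 | h1
  · have := hcard 0 0 1 (by simpa using sq_nonneg kF) (by decide +kernel)
    have h2 : kF ^ 3 ≤ 1 := pow_le_one₀ hkF h1.le
    push_cast at this
    linarith
  rcases lt_or_ge kF 2 with h2 | h2
  · have := hcard 1 1 7 (by push_cast; nlinarith) (by decide +kernel)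
    have h3 : kF ^ 3 ≤ 2 ^ 3 := pow_le_pow_left₀ hkF h2.le 3
    push_cast at this
    linarith
  rcases lt_or_ge kF 3.47 with h3 | h3
  · have := hcard 4 2 33 (by push_cast; nlinarith) (by decide +kernel)
    have h4 : kF ^ 3 ≤ 3.47 ^ 3 := pow_le_pow_left₀ hkF h3.le 3
    push_cast at this
    norm_num at h4 ⊢
    linarith
  · -- the cube of half side `n = ⌊kF / √3⌋`, with `√3` replaced by an upper bound
    set n : ℕ := ⌊kF / 1.733⌋₊ with hn
    have hn1 : (n : ℝ) * 1.733 ≤ kF := by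
      have := Nat.floor_le (div_nonneg hkF (by norm_num : (0 : ℝ) ≤ 1.733))
      rwa [le_div_iff₀ (by norm_num)] at this
    have hn2 : kF < ((n : ℝ) + 1) * 1.733 := by
      have := Nat.lt_floor_add_one (kF / 1.733)
      rwa [div_lt_iff₀ (by norm_num)] at this
    have hn3 : 2 ≤ n := Nat.le_floor (by rw [le_div_iff₀ (by norm_num)]; norm_num; linarith)
    have hn3' : (2 : ℝ) ≤ n := by exact_mod_cast hn3
    have hc : (2 * n + 1) ^ 3 ≤ (fermiBall kF).card := by
      have h5 := card_le_card_fermiBall hkF (m := 3 * (n : ℤ) ^ 2) (by push_cast; nlinarith)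
        (Fintype.piFinset fun _ : Fin 3 => Finset.Icc (-(n : ℤ)) n) ?_
      · rw [Fintype.card_piFinset] at h5
        simp only [Int.card_Icc, Finset.prod_const, Finset.card_univ, Fintype.card_fin] at h5
        convert h5 using 2
        omega
      · intro h hh
        rw [Fintype.mem_piFinset] at hh
        have : ∀ i, h i ^ 2 ≤ (n : ℤ) ^ 2 := fun i => by
          have := Finset.mem_Icc.mp (hh i)
          nlinarith
        calc ∑ i, h i ^ 2 ≤ ∑ _i : Fin 3, (n : ℤ) ^ 2 := Finset.sum_le_sum fun i _ => this i
          _ = _ := by simp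
    have hc' : (2 * (n : ℝ) + 1) ^ 3 ≤ (fermiBall kF).card := by exact_mod_cast hc
    have h6 : kF ≤ 1.05 * (2 * (n : ℝ) + 1) := by nlinarith
    calc kF ^ 3 ≤ (1.05 * (2 * (n : ℝ) + 1)) ^ 3 := pow_le_pow_left₀ hkF h6 3
      _ = 1.05 ^ 3 * (2 * (n : ℝ) + 1) ^ 3 := by ring
      _ ≤ 1.45 * (2 * (n : ℝ) + 1) ^ 3 := by gcongr; norm_num
      _ ≤ _ := by gcongr

theorem two_mul_fermiRadius_le {kF : ℝ} (hkF : 0 ≤ kF) :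
    2 * kF ≤ (2 * √2 - 1) *
      ((6 / Real.pi) ^ (1 / 3 : ℝ) * ((fermiBall kF).card : ℝ) ^ (1 / 3 : ℝ)) := by
  set a := (6 / Real.pi) ^ (1 / 3 : ℝ) * ((fermiBall kF).card : ℝ) ^ (1 / 3 : ℝ)
  have hpi := Real.pi_pos
  have ha : 0 ≤ a := by positivity
  have ha3 : a ^ 3 = 6 / Real.pi * (fermiBall kF).card := by
    rw [mul_pow, ← Real.rpow_natCast, ← Real.rpow_natCast, ← Real.rpow_mul (by positivity),
      ← Real.rpow_mul (by positivity)]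
    norm_num
  have h2 : (1.828 : ℝ) ≤ 2 * √2 - 1 := by
    have : (1.414 : ℝ) ≤ √2 := Real.le_sqrt_of_sq_le (by norm_num)
    linarith
  have hp : (1.909 : ℝ) ≤ 6 / Real.pi := by
    rw [le_div_iff₀ hpi]
    have := Real.pi_lt_d4
    linarith
  have h3 : (2 * kF) ^ 3 ≤ (1.828 * a) ^ 3 := by
    have h4 := cube_le_card_fermiBall hkF
    have h5 : 1.909 * ((fermiBall kF).card : ℝ) ≤ a ^ 3 := by rw [ha3]; gcongr
    nlinarith
  have h6 := le_of_pow_le_pow_left₀ (by norm_num) (by positivity) h3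
  exact h6.trans (by gcongr)

/-! ### Comparison of the error bounds -/

theorem exp_sub_one_le (x : ℝ) : Real.exp x - 1 ≤ x * Real.exp x := by
  have h := Real.add_one_le_exp (-x)
  have h2 : Real.exp x * Real.exp (-x) = 1 := by rw [← Real.exp_add]; simp
  nlinarith [Real.exp_pos x]

theorem sinh_le_mul_exp {x : ℝ} (hx : 0 ≤ x) : Real.sinh x ≤ x * Real.exp x := by
  have h1 := exp_sub_one_le x
  have h2 := Real.add_one_le_exp (-x)
  have h3 : x ≤ x * Real.exp x := le_mul_of_one_le_right hx (Real.one_le_exp hx)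
  rw [Real.sinh_eq]
  linarith

/-- The error of the pair mode dynamics is dominated by the stated one. Here `κ` is the mean of the
pair energies, `D` their bound, `X` stands for `xiSum`. -/
theorem modeError_le {x X M D κ f G w : ℝ} (hx : 0 ≤ x) (hX : 0 ≤ X) (hM : 0 ≤ M)
    (hκ : |κ| = w * |f|) (hκD : |κ| ≤ D) (hD : D ≤ w * (2 * √2 * G)) :
    |κ| * (2 * Real.sinh x * (X * (M / √2) * (Real.exp x - 1))
        + (X * (M / √2) * (Real.exp x - 1)) ^ 2)
      + 2 * (D * (X * (M / √2))) * Real.sinh x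
      + D * (X * (M / √2)) * (X * (M / √2) * (Real.exp x - 1)) ≤
    4 * w * (2 * x * |f| * Real.sinh x * M * Real.exp x * (2 * X)
      + G * X * M * (Real.sinh x + M * (Real.sinh x * Real.exp x) * X)) := by
  have hsh : 0 ≤ Real.sinh x := Real.sinh_nonneg_iff.mpr hx
  have hy : 1 ≤ Real.exp x := Real.one_le_exp hx
  have hy1 := exp_sub_one_le x
  have h2 : 0 < √2 := by positivity
  have hs2 : √2 * √2 = 2 := Real.mul_self_sqrt two_pos.le
  have hshy : Real.sinh x * Real.exp x = (Real.exp x ^ 2 - 1) / 2 := by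
    have h : Real.exp (-x) * Real.exp x = 1 := by rw [← Real.exp_add]; simp
    rw [Real.sinh_eq]
    linear_combination (-1 / 2) * h
  have hD0 : 0 ≤ D := (abs_nonneg κ).trans hκD
  have hG0 : 0 ≤ w * G := by nlinarith
  set y := Real.exp x
  set s := Real.sinh x
  set η := X * (M / √2) with hη
  have hη0 : 0 ≤ η := by positivity
  have hη1 : √2 * η = X * M := by rw [hη]; field_simp
  have hη2 : 2 * η ^ 2 = (X * M) ^ 2 := by rw [← hη1]; nlinarith
  have hηXM : η ≤ X * M := by
    rw [← hη1]
    exact le_mul_of_one_le_left hη0 (Real.one_le_sqrt.mpr one_le_two)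
  have hXM : 0 ≤ X * M := mul_nonneg hX hM
  have t1 : |κ| * (2 * s * (η * (y - 1))) ≤ 16 * (w * |f|) * (x * s * y * (X * M)) := by
    rw [← hκ]
    calc |κ| * (2 * s * (η * (y - 1))) ≤ |κ| * (2 * s * ((X * M) * (x * y))) := by gcongr
      _ = 2 * (|κ| * (x * s * y * (X * M))) := by ring
      _ ≤ 16 * (|κ| * (x * s * y * (X * M))) := by
          have : 0 ≤ |κ| * (x * s * y * (X * M)) := by positivity
          linarith
      _ = _ := by ring
  have t3 : 2 * (D * η) * s ≤ 4 * (w * G) * (X * M * s) := by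
    calc 2 * (D * η) * s ≤ 2 * (w * (2 * √2 * G) * η) * s := by gcongr
      _ = 4 * (w * G) * ((√2 * η) * s) := by ring
      _ = _ := by rw [hη1]
  have t24 : |κ| * (η * (y - 1)) ^ 2 + D * η * (η * (y - 1)) ≤
      4 * (w * G) * ((X * M) ^ 2 * (s * y)) := by
    calc |κ| * (η * (y - 1)) ^ 2 + D * η * (η * (y - 1))
        ≤ D * (η * (y - 1)) ^ 2 + D * η * (η * (y - 1)) := by gcongr
      _ = D * (2 * η ^ 2) * ((y - 1) * y / 2) := by ring
      _ ≤ D * (2 * η ^ 2) * (s * y) := by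
          gcongr
          rw [hshy]
          nlinarith
      _ ≤ w * (2 * √2 * G) * (2 * η ^ 2) * (s * y) := by gcongr
      _ = 2 * √2 * ((w * G) * ((X * M) ^ 2 * (s * y))) := by rw [hη2]; ring
      _ ≤ 4 * ((w * G) * ((X * M) ^ 2 * (s * y))) := by
          have : √2 ≤ 2 := Real.sqrt_le_left (by norm_num) |>.mpr (by norm_num)
          have h0 : 0 ≤ (w * G) * ((X * M) ^ 2 * (s * y)) := by positivity
          nlinarith
      _ = _ := by ring
  calc |κ| * (2 * s * (η * (y - 1)) + (η * (y - 1)) ^ 2) + 2 * (D * η) * s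
        + D * η * (η * (y - 1))
      = |κ| * (2 * s * (η * (y - 1))) + 2 * (D * η) * s
        + (|κ| * (η * (y - 1)) ^ 2 + D * η * (η * (y - 1))) := by ring
    _ ≤ 16 * (w * |f|) * (x * s * y * (X * M)) + 4 * (w * G) * (X * M * s)
        + 4 * (w * G) * ((X * M) ^ 2 * (s * y)) := by gcongr
    _ = _ := by ring

theorem abs_pairMean_le {kF : ℝ} {g : Mode → ℝ} {k : Mode} {D : ℝ} (hD0 : 0 ≤ D)
    (hD : ∀ h ∈ lune kF k, |g h| ≤ D) : |pairMean kF g k| ≤ D := by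
  rw [pairMean, pairNorm_sq, abs_mul, abs_inv, Nat.abs_cast]
  have h1 : |∑ h ∈ lune kF k, g h| ≤ (lune kF k).card * D := by
    refine (Finset.abs_sum_le_sum_abs _ _).trans ((Finset.sum_le_sum hD).trans (by simp))
  calc _ ≤ ((lune kF k).card : ℝ)⁻¹ * ((lune kF k).card * D) := by gcongr
    _ ≤ D := by
      rw [← mul_assoc]
      exact mul_le_of_le_one_left hD0 inv_mul_le_one

section Comparison

variable {N : ℕ} {kF : ℝ}

theorem abs_kineticWeight_le {k h : Mode} (hh : h ∈ lune kF k) :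
    |kineticWeight N k h| ≤ hbar N ^ 2 * (‖vec k‖ * (2 * kF + ‖vec k‖)) := by
  have hh' := mem_fermiBall.mp (mem_lune.mp hh).1
  rw [kineticWeight, abs_mul, abs_of_nonneg (by positivity)]
  gcongr
  refine (abs_real_inner_le_norm _ _).trans ?_
  gcongr
  rw [vec_add]
  calc ‖vec h + vec k + vec h‖ ≤ ‖vec h + vec k‖ + ‖vec h‖ := norm_add_le _ _
    _ ≤ ‖vec h‖ + ‖vec k‖ + ‖vec h‖ := by gcongr; exact norm_add_le _ _
    _ ≤ _ := by linarith

theorem abs_kDotF_le (hkF : 0 ≤ kF) (k : Mode) :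
    |kDotF kF k| ≤ ‖vec k‖ * (2 * kF + ‖vec k‖) := by
  have h := abs_pairMean_le (kF := kF) (g := kineticWeight 1 k) (k := k)
    (D := hbar 1 ^ 2 * (‖vec k‖ * (2 * kF + ‖vec k‖))) (by positivity)
    fun h hh => abs_kineticWeight_le hh
  have h1 : hbar 1 = 1 := by simp [hbar]
  simpa [pairMean_kineticWeight, h1] using h

theorem abs_kDotF_le_sq (hkF : 0 ≤ kF) {k : Mode} (hk : k ≠ 0) :
    |kDotF kF k| ≤ (2 * kF + 1) * ‖vec k‖ ^ 2 := by
  have h1 := one_le_norm_vec hk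
  refine (abs_kDotF_le hkF k).trans ?_
  nlinarith [mul_nonneg hkF (norm_nonneg (vec k))]

section Summability

variable {Ξ : Mode → ℂ}

theorem xiSum_le (hB : (fermiBall kF).Nonempty) (hΞ : Summable fun k : NZ => ‖Ξ k.1‖) (k : NZ) :
    xiSum kF Ξ k.1 ≤ ∑' m : NZ, ‖Ξ m.1‖ := by
  refine (summable_xiSum hB hΞ k.2).tsum_le_tsum (fun m => ?_) hΞ
  exact div_le_self (norm_nonneg _)
    (one_le_mul_of_one_le_of_one_le (one_le_pairNorm hB m.2) (one_le_pairNorm hB k.2))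

theorem sinh_norm_le (hΞ : Summable fun k : NZ => ‖Ξ k.1‖) (k : NZ) :
    Real.sinh ‖Ξ k.1‖ ≤ ‖Ξ k.1‖ * Real.exp (∑' m : NZ, ‖Ξ m.1‖) := by
  refine (sinh_le_mul_exp (norm_nonneg _)).trans ?_
  gcongr
  exact hΞ.le_tsum k fun _ _ => norm_nonneg _

theorem summable_kDotF_sinh_sq (hkF : 0 ≤ kF) (hΞ : Summable fun k : NZ => ‖Ξ k.1‖)
    (hΞ2 : Summable fun k : NZ => ‖vec k.1‖ ^ 2 * ‖Ξ k.1‖) :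
    Summable fun k : NZ => hbar N ^ 2 * kDotF kF k.1 * Real.sinh ‖Ξ k.1‖ ^ 2 := by
  set K := ∑' m : NZ, ‖Ξ m.1‖ with hK
  have hK0 : 0 ≤ K := tsum_nonneg fun _ => norm_nonneg _
  refine Summable.of_norm_bounded
    (hΞ2.mul_left (hbar N ^ 2 * (2 * kF + 1) * K * Real.exp K ^ 2)) fun k => ?_
  have h1 := abs_kDotF_le_sq hkF k.2
  have h2 := sinh_norm_le hΞ k
  have h3 : ‖Ξ k.1‖ ≤ K := hΞ.le_tsum k fun _ _ => norm_nonneg _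
  have h4 : 0 ≤ Real.sinh ‖Ξ k.1‖ := Real.sinh_nonneg_iff.mpr (norm_nonneg _)
  rw [Real.norm_eq_abs, abs_mul, abs_mul, abs_of_nonneg (sq_nonneg (hbar N)),
    abs_of_nonneg (sq_nonneg (Real.sinh _))]
  calc hbar N ^ 2 * |kDotF kF k.1| * Real.sinh ‖Ξ k.1‖ ^ 2
      ≤ hbar N ^ 2 * ((2 * kF + 1) * ‖vec k.1‖ ^ 2) *
        ((‖Ξ k.1‖ * Real.exp K) * (K * Real.exp K)) := by
        rw [sq (Real.sinh _)]
        have h5 : Real.sinh ‖Ξ k.1‖ ≤ K * Real.exp K := h2.trans (by gcongr)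
        gcongr
    _ = _ := by ring

theorem errorTerm_nonneg {M : ℝ} (hM : 0 ≤ M) (k : Mode) : 0 ≤ errorTerm N kF Ξ M k := by
  have h1 : 0 ≤ Real.sinh ‖Ξ k‖ := Real.sinh_nonneg_iff.mpr (norm_nonneg _)
  have h2 := xiSum_nonneg (kF := kF) (Ξ := Ξ) k
  have h3 : 0 ≤ max ((6 / Real.pi) ^ (1 / 3 : ℝ) * (N : ℝ) ^ (1 / 3 : ℝ)) ‖vec k‖ :=
    (norm_nonneg _).trans (le_max_right _ _)
  unfold errorTerm
  positivity

theorem summable_errorTerm (hkF : 0 ≤ kF) (hB : (fermiBall kF).Nonempty)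
    (hΞ : Summable fun k : NZ => ‖Ξ k.1‖)
    (hΞ2 : Summable fun k : NZ => ‖vec k.1‖ ^ 2 * ‖Ξ k.1‖) {M : ℝ} (hM : 0 ≤ M) :
    Summable fun k : NZ => errorTerm N kF Ξ M k.1 := by
  set K := ∑' m : NZ, ‖Ξ m.1‖ with hK
  have hK0 : 0 ≤ K := tsum_nonneg fun _ => norm_nonneg _
  set a := (6 / Real.pi) ^ (1 / 3 : ℝ) * (N : ℝ) ^ (1 / 3 : ℝ) with ha
  have ha0 : 0 ≤ a := by have := Real.pi_pos; positivity
  refine Summable.of_nonneg_of_le (fun k => errorTerm_nonneg hM k.1) (fun k => ?_)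
    (hΞ2.mul_left (2 * K * (2 * kF + 1) * Real.exp K * M * Real.exp K * (2 * K)
      + (a + 1) * K * M * (Real.exp K + M * (Real.exp K * Real.exp K) * K)))
  have h1 := abs_kDotF_le_sq hkF k.2
  have h2 := sinh_norm_le hΞ k
  have h3 : ‖Ξ k.1‖ ≤ K := hΞ.le_tsum k fun _ _ => norm_nonneg _
  have h4 : 0 ≤ Real.sinh ‖Ξ k.1‖ := Real.sinh_nonneg_iff.mpr (norm_nonneg _)
  have h5 := xiSum_le hB hΞ k
  have h6 := xiSum_nonneg (kF := kF) (Ξ := Ξ) k.1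
  have h7 := one_le_norm_vec k.2
  have h8 : max a ‖vec k.1‖ * ‖vec k.1‖ ≤ (a + 1) * ‖vec k.1‖ ^ 2 := by
    rw [sq, ← mul_assoc]
    gcongr
    refine max_le ?_ ?_ <;> nlinarith
  have h9 : 0 ≤ max a ‖vec k.1‖ := ha0.trans (le_max_left _ _)
  calc errorTerm N kF Ξ M k.1
      ≤ 2 * K * ((2 * kF + 1) * ‖vec k.1‖ ^ 2) * (‖Ξ k.1‖ * Real.exp K) * M * Real.exp K * (2 * K)
        + ((a + 1) * ‖vec k.1‖ ^ 2) * K * M * ((‖Ξ k.1‖ * Real.exp K)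
          + M * ((‖Ξ k.1‖ * Real.exp K) * Real.exp K) * K) := by
        unfold errorTerm
        gcongr
    _ = _ := by ring

end Summability

/-- The energy of a pair mode differs from its bosonic value by at most the stated error. -/
theorem abs_pairEnergy_kinetic_sub_le {Ξ : Mode → ℂ} (hkF : 0 ≤ kF)
    (hcard : (fermiBall kF).card = N)
    (hB : (fermiBall kF).Nonempty) (hΞ : Summable fun k : NZ => ‖Ξ k.1‖)
    (hsymm : ∀ k, Ξ (-k) = Ξ k) {M : ℝ} (hM : 0 ≤ M)
    (hψ : ∀ t ∈ Set.Icc (0 : ℝ) 1,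
      numberMoment (fun n => ((n + 2 : ℕ) : ENNReal) ^ 3) (bogT kF Ξ t vacuum) ≤
        ENNReal.ofReal (M ^ 2)) (k : NZ) :
    |pairEnergy kF Ξ (kineticWeight N k.1) k.1
        - hbar N ^ 2 * kDotF kF k.1 * Real.sinh ‖Ξ k.1‖ ^ 2| ≤
      4 * hbar N ^ 2 * errorTerm N kF Ξ M k.1 := by
  have hD0 : 0 ≤ hbar N ^ 2 * (‖vec k.1‖ * (2 * kF + ‖vec k.1‖)) := by positivity
  have hD : ∀ h ∈ lune kF k.1, |kineticWeight N k.1 h| ≤ _ := fun h hh => abs_kineticWeight_le hh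
  have h1 := abs_pairEnergy_sub_le hB hΞ hsymm k.2 hD0 hD hM hψ rfl
  have h2 := abs_pairMean_le hD0 hD
  rw [pairMean_kineticWeight] at h1 h2
  refine h1.trans ?_
  have hG : hbar N ^ 2 * (‖vec k.1‖ * (2 * kF + ‖vec k.1‖)) ≤ hbar N ^ 2 * (2 * √2 *
      (max ((6 / Real.pi) ^ (1 / 3 : ℝ) * (N : ℝ) ^ (1 / 3 : ℝ)) ‖vec k.1‖ * ‖vec k.1‖)) := by
    have h3 := two_mul_fermiRadius_le hkF
    rw [hcard] at h3
    set a := (6 / Real.pi) ^ (1 / 3 : ℝ) * (N : ℝ) ^ (1 / 3 : ℝ)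
    have h4 : (1 : ℝ) ≤ √2 := Real.one_le_sqrt.mpr one_le_two
    have h5 : 2 * kF + ‖vec k.1‖ ≤ 2 * √2 * max a ‖vec k.1‖ := by
      calc 2 * kF + ‖vec k.1‖ ≤ (2 * √2 - 1) * max a ‖vec k.1‖ + max a ‖vec k.1‖ := by
            refine add_le_add (h3.trans ?_) (le_max_right _ _)
            exact mul_le_mul_of_nonneg_left (le_max_left _ _) (by linarith)
        _ = _ := by ring
    calc hbar N ^ 2 * (‖vec k.1‖ * (2 * kF + ‖vec k.1‖))
        ≤ hbar N ^ 2 * (‖vec k.1‖ * (2 * √2 * max a ‖vec k.1‖)) := by gcongr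
      _ = _ := by ring
  exact modeError_le (norm_nonneg _) (xiSum_nonneg _) hM
    (by rw [abs_mul, abs_of_nonneg (sq_nonneg (hbar N))]) h2 hG

end Comparison

end FermiGas

end

open FermiGas in
theorem mainTheorem6 (N : ℕ) (hN : 1 ≤ N) (kF : ℝ) (hkF : (fermiBall kF).card = N)
    (Ξ : Mode → ℂ) (hsymm : ∀ k, Ξ (-k) = Ξ k)
    (hsum : Summable fun k : Mode => ‖vec k‖ ^ 2 * ‖Ξ k‖) :
    -- the generator of the trial state is a norm-convergent series
    Summable (fun k : NZ => Ξ k.1 • (bStar kF k.1 * bStar kF (-k.1))) ∧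
    -- the series in the statement converge
    Summable (fun k : NZ => hbar N ^ 2 * kDotF kF k.1 * Real.sinh ‖Ξ k.1‖ ^ 2) ∧
    (∀ k : NZ, Summable fun m : NZ => ‖Ξ m.1‖ / (pairNorm kF m.1 * pairNorm kF k.1)) ∧
    -- the trial states lie in the domains of the unbounded operators
    ∃ hH : bogT kF Ξ 1 vacuum ∈ (kineticOp N kF).domain,
    ∃ hM : ∀ t : Set.Icc (0 : ℝ) 1, bogT kF Ξ t vacuum ∈ numberPlusTwoPow.domain,
    BddAbove (Set.range fun t : Set.Icc (0 : ℝ) 1 =>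
      ‖numberPlusTwoPow ⟨bogT kF Ξ t vacuum, hM t⟩‖) ∧
    ∃ M : ℝ, M = (⨆ t : Set.Icc (0 : ℝ) 1, ‖numberPlusTwoPow ⟨bogT kF Ξ t vacuum, hM t⟩‖) ∧
    Summable (fun k : NZ => errorTerm N kF Ξ M k.1) ∧
    ∃ ε₂ : ℂ,
      inner ℂ (bogT kF Ξ 1 vacuum) (kineticOp N kF ⟨bogT kF Ξ 1 vacuum, hH⟩) =
        (((∑' k : NZ, hbar N ^ 2 * kDotF kF k.1 * Real.sinh ‖Ξ k.1‖ ^ 2)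
          + 2 * ε₂.re : ℝ) : ℂ) ∧
      ‖ε₂‖ ≤ 2 * hbar N ^ 2 * ∑' k : NZ, errorTerm N kF Ξ M k.1 := by
  have hB : (fermiBall kF).Nonempty := Finset.card_pos.mp (by omega)
  have hkF0 : 0 ≤ kF := by
    obtain ⟨h, hh⟩ := hB
    exact (norm_nonneg _).trans (mem_fermiBall.mp hh)
  have hΞ2 : Summable fun k : NZ => ‖vec k.1‖ ^ 2 * ‖Ξ k.1‖ :=
    hsum.comp_injective Subtype.val_injective
  have hΞ : Summable fun k : NZ => ‖Ξ k.1‖ :=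
    Summable.of_nonneg_of_le (fun _ => norm_nonneg _)
      (fun k => le_mul_of_one_le_left (norm_nonneg _) (one_le_pow₀ (one_le_norm_vec k.2))) hΞ2
  have hH := bogT_vacuum_mem_domain_kineticOp (N := N) hkF0 hB hΞ hsymm hΞ2
  have hdom : ∀ t : Set.Icc (0 : ℝ) 1, bogT kF Ξ t vacuum ∈ numberPlusTwoPow.domain := fun t =>
    mem_domain_numberPlusTwoPow (bogT_vacuum_mem_balancedSpace hB hΞ t)
  have hbdd : BddAbove (Set.range fun t : Set.Icc (0 : ℝ) 1 =>
      ‖numberPlusTwoPow ⟨bogT kF Ξ t vacuum, hdom t⟩‖) := by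
    refine ⟨(2 * (fermiBall kF).card + 2) ^ 2, ?_⟩
    rintro _ ⟨t, rfl⟩
    have h := norm_numberPlusTwoPow_le (bogT_vacuum_mem_balancedSpace hB hΞ t) (hdom t)
    rwa [norm_bogT_vacuum, mul_one] at h
  refine ⟨summable_bogCreate hB hΞ, summable_kDotF_sinh_sq hkF0 hΞ hΞ2,
    fun k => summable_xiSum hB hΞ k.2, hH, hdom, hbdd, _, rfl, ?_⟩
  set M := ⨆ t : Set.Icc (0 : ℝ) 1, ‖numberPlusTwoPow ⟨bogT kF Ξ t vacuum, hdom t⟩‖ with hMdef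
  have hM0 : 0 ≤ M := Real.iSup_nonneg fun _ => norm_nonneg _
  have hψ : ∀ t ∈ Set.Icc (0 : ℝ) 1,
      numberMoment (fun n => ((n + 2 : ℕ) : ENNReal) ^ 3) (bogT kF Ξ t vacuum) ≤
        ENNReal.ofReal (M ^ 2) := by
    intro t ht
    rw [← enorm_numberPlusTwoPow_sq (hdom ⟨t, ht⟩), ← ofReal_norm,
      ← ENNReal.ofReal_pow (norm_nonneg _)]
    gcongr
    exact le_ciSup hbdd ⟨t, ht⟩
  have herr := summable_errorTerm (N := N) hkF0 hB hΞ hΞ2 hM0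
  have hmain := summable_kDotF_sinh_sq (N := N) hkF0 hΞ hΞ2
  have hdiff := fun k : NZ => abs_pairEnergy_kinetic_sub_le hkF0 hkF hB hΞ hsymm hM0 hψ k
  have hdiffs : Summable fun k : NZ => pairEnergy kF Ξ (kineticWeight N k.1) k.1
      - hbar N ^ 2 * kDotF kF k.1 * Real.sinh ‖Ξ k.1‖ ^ 2 :=
    Summable.of_norm_bounded (herr.mul_left (4 * hbar N ^ 2)) hdiff
  have hE : Summable fun k : NZ => pairEnergy kF Ξ (kineticWeight N k.1) k.1 :=
    (hdiffs.add hmain).congr fun k => by ring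
  -- the energy is real, so half the deviation from the main term serves as `ε₂`
  refine ⟨herr, ((((∑' k : NZ, pairEnergy kF Ξ (kineticWeight N k.1) k.1)
    - ∑' k : NZ, hbar N ^ 2 * kDotF kF k.1 * Real.sinh ‖Ξ k.1‖ ^ 2) / 2 : ℝ) : ℂ), ?_, ?_⟩
  · rw [inner_kineticOp_bogT hkF0 hB hΞ hsymm hΞ2 hH, Complex.ofReal_re]
    congr 1
    ring
  · rw [Complex.norm_real, norm_div, Real.norm_two, ← hE.tsum_sub hmain]
    have h := tsum_of_norm_bounded (herr.hasSum.mul_left (4 * hbar N ^ 2))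
      fun k => (Real.norm_eq_abs _).trans_le (hdiff k)
    linarith
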